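/- **Conventions.** For $n\ge 1$ let $[\mathbb N]^n$ be the set of $n$-element subsets of $\mathbb N$. For a natural number $k$ let $\mathcal C_{n,k}$ be the set of colorings $c:[\mathbb N]^n\to\{0,\dots,k-1\}$, and let $\mathcal C_{n,\mathbb N}$ be the set of colorings $c:[\mathbb N]^n\to\mathbb N$ with finite range. A point $p\in\mathbb N^{\mathbb N}$ is a *name* of $c$ if $p(i)=c(\vartheta_n(i))$ for all $i$, where $\vartheta_n:\mathbb N\to[\mathbb N]^n$ is a standard computable surjective numbering. Let $\mathcal H_c$ be the set of infinite $M\subseteq\mathbb N$ that are homogeneous for $c$ (i.e. $c$ is constant on $[M]^n$); the *name* of $M\subseteq\mathbb N$ is its characteristic function. A coloring $c$ is *stable* if $\lim_{i\to\infty}c(A\cup\{i\})$ exists for every $A\in[\mathbb N]^{n-1}$. The problem $\mathsf{RT}_{n,k}$ is the multivalued function with domain $\mathcal C_{n,k}$ and $c\mapsto\mathcal H_c$, and $\mathsf{SRT}_{n,k}$ is its restriction to the stable colorings. A *realizer* of such a problem is a partial function $F:\subseteq\mathbb N^{\mathbb N}\to\mathbb N^{\mathbb N}$ that is defined on every name of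 every $c$ in the domain of the problem and maps it to a name of some $M\in\mathcal H_c$. Names of $\boldsymbol\Sigma^0_m$ subsets of $\mathbb N^{\mathbb N}$ are defined inductively: a name of an open ($\boldsymbol\Sigma^0_1$) set is an enumeration of (codes of) finite words whose cylinders have that set as their union; a name of a $\boldsymbol\Sigma^0_{m+1}$ set $V$ is (a code $\langle p_0,p_1,\dots\rangle$ of) a sequence of names of $\boldsymbol\Sigma^0_m$ sets $V_0,V_1,\dots$ with $V=\bigcup_i(\mathbb N^{\mathbb N}\setminus V_i)$. A partial function $F:\subseteq\mathbb N^{\mathbb N}\to\mathbb N^{\mathbb N}$ is *effectively $\boldsymbol\Sigma^0_m$-measurable* if there is a computable map $\Phi:\mathbb N^{\mathbb N}\to\mathbb N^{\mathbb N}$ that sends every name of an open set $U$ to a name of a $\boldsymbol\Sigma^0_m$ set $V$ with $F^{-1}(U)=V\cap\operatorname{dom}(F)$. A problem is *effectively $\boldsymbol\Sigma^0_m$-measurable* if it has an effectively $\boldsymbol\Sigma^0_m$-measurable realizer. **Statement.** Let $n\ge 1$, and let $k\ge 2$ be a natural number or $k=\mathbb N$. Then: 1. $\mathsf{SRT}_{n,k}$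 and $\mathsf{RT}_{n,k}$ are effectively $\boldsymbol\Sigma^0_{n+2}$-measurable; 2. $\mathsf{RT}_{n,k}$ is not effectively $\boldsymbol\Sigma^0_{n+1}$-measurable; 3. if $n\ge 2$, then $\mathsf{SRT}_{n,k}$ is not effectively $\boldsymbol\Sigma^0_{n+1}$-measurable. -/

import Mathlib

/-! ### Baire space and computable operators on it -/

/-- Baire space. -/
abbrev Baire : Type := ℕ → ℕ

/-- The finite prefix `p 0, …, p (m - 1)` of a point of Baire space. -/
def Baire.prefixList (p : Baire) (m : ℕ) : List ℕ := (List.range m).map p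

/-- The `i`-th component `pᵢ` of `p = ⟨p₀, p₁, p₂, …⟩`, where `⟨p₀, p₁, …⟩⟨i, k⟩ = pᵢ k`. -/
def Baire.row (p : Baire) (i : ℕ) : Baire := fun k => p (Nat.pair i k)

/-- A (total) map on Baire space is computable if it is approximated by a computable map on
finite words that is monotone for the prefix order: `Φ p` is the supremum of the words
`φ (p 0, …, p (m - 1))`. -/
def ComputableOperator (Φ : Baire → Baire) : Prop :=
  ∃ φ : List ℕ → List ℕ, Computable φ ∧ (∀ u v, u <+: v → φ u <+: φ v) ∧
    ∀ p : Baire,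
      (∀ m, φ (p.prefixList m) = (Φ p).prefixList (φ (p.prefixList m)).length) ∧
      ∀ l, ∃ m, l ≤ (φ (p.prefixList m)).length

/-! ### The representations of the finite levels of the Borel hierarchy of Baire space -/

/-- `sigmaSet n p` is the `𝚺⁰ₙ` subset of Baire space (`n ≥ 1`) with name `p`.
For `n = 1`, the name lists codes (shifted by `1`, so that `0` stands for "no information") of
finite words, and the set is the union of the corresponding cylinders.
A name of a `𝚺⁰ₙ₊₁` set is a sequence of names of `𝚺⁰ₙ` sets, and the set is the union of
their complements. The value at `n = 0` is meaningless. -/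
def sigmaSet : ℕ → Baire → Set Baire
  | 0, _ => ∅
  | 1, p => {x | ∃ i m, p i = Encodable.encode (x.prefixList m) + 1}
  | n + 2, p => ⋃ i, (sigmaSet (n + 1) (p.row i))ᶜ

/-- A partial function `F` on Baire space is effectively `𝚺⁰ₙ`-measurable if from (a name of) an
open set `U` one can compute (a name of) a `𝚺⁰ₙ` set `V` with `F⁻¹(U) = V ∩ dom F`. -/
def EffectivelySigmaMeasurable (n : ℕ) (F : Baire →. Baire) : Prop :=
  ∃ Φ : Baire → Baire, ComputableOperator Φ ∧
    ∀ p : Baire, F.preimage (sigmaSet 1 p) = sigmaSet n (Φ p) ∩ F.Dom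

/-! ### Represented spaces and problems -/

/-- A represented space: a set with a surjective partial map from Baire space, given here by
its graph `Names`. -/
class RepresentedSpace (X : Type) where
  /-- `Names p x`: the point `p` of Baire space is a name of `x`. -/
  Names : Baire → X → Prop
  names_unique : ∀ p x y, Names p x → Names p y → x = y
  exists_name : ∀ x, ∃ p, Names p x

/-- A problem, i.e. a partial multivalued function: `dom` is its set of instances and
`sol x` the set of solutions of the instance `x`. -/
structure Problem (X Y : Type) where
  dom : Set X
  sol : X → Set Y

/-- `F` realizes the problem `f`: it sends every name of an instance to a name of one of the
solutions of that instance. -/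
def Problem.RealizedBy {X Y : Type} [RepresentedSpace X] [RepresentedSpace Y]
    (f : Problem X Y) (F : Baire →. Baire) : Prop :=
  ∀ p x, RepresentedSpace.Names p x → x ∈ f.dom →
    ∃ q ∈ F p, ∃ y ∈ f.sol x, RepresentedSpace.Names q y

/-- A problem is effectively `𝚺⁰ₙ`-measurable if it has an effectively `𝚺⁰ₙ`-measurable
realizer. -/
def Problem.EffectivelySigmaMeasurable {X Y : Type} [RepresentedSpace X] [RepresentedSpace Y]
    (n : ℕ) (f : Problem X Y) : Prop :=
  ∃ F : Baire →. Baire, f.RealizedBy F ∧ _root_.EffectivelySigmaMeasurable n F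

/-- Sets of natural numbers, as points of Cantor space: the name of `M` is its characteristic
function. -/
instance : RepresentedSpace (Set ℕ) where
  Names q M := ∀ i, (i ∈ M → q i = 1) ∧ (i ∉ M → q i = 0)
  names_unique := by
    intro p M N hM hN
    ext i
    have h1 := hM i
    have h2 := hN i
    by_cases a : i ∈ M <;> by_cases b : i ∈ N <;> simp_all
  exists_name := by
    classical
    intro M
    refine ⟨fun i => if i ∈ M then 1 else 0, fun i => ⟨fun h => ?_, fun h => ?_⟩⟩ <;> simp [h]

/-! ### The standard numbering of the `n`-element sets of natural numbers -/

/-- The set `[ℕ]ⁿ` of `n`-element sets of natural numbers. -/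
abbrev NSubset (n : ℕ) : Type := {A : Finset ℕ // A.card = n}

/-- `tupleEntry n i j` is the entry `i_j` of the `n`-tuple with code
`i = ⟨i_0, ⟨i_1, …, i_(n-1)⟩⟩`. -/
def tupleEntry : ℕ → ℕ → ℕ → ℕ
  | 0, _, _ => 0
  | 1, i, _ => i
  | _ + 2, i, 0 => i.unpair.1
  | n + 2, i, j + 1 => tupleEntry (n + 1) i.unpair.2 j

/-- The numbering `ϑₙ⟨i_0, …, i_(n-1)⟩ = {k + ∑_{j ≤ k} i_j : k < n}` of `[ℕ]ⁿ`. -/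
def theta (n i : ℕ) : NSubset n :=
  ⟨(Finset.range n).image (fun k => k + ∑ j ∈ Finset.range (k + 1), tupleEntry n i j), by
    rw [Finset.card_image_of_injective, Finset.card_range]
    apply StrictMono.injective
    apply strictMono_nat_of_lt_succ
    intro k
    rw [Finset.sum_range_succ _ (k + 1)]
    omega⟩

theorem exists_tupleEntry (n : ℕ) (d : ℕ → ℕ) : ∃ i, ∀ j < n, tupleEntry n i j = d j := by
  induction n generalizing d with
  | zero => exact ⟨0, by simp⟩
  | succ n ih =>
    cases n with
    | zero =>
      refine ⟨d 0, fun j hj => ?_⟩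
      obtain rfl : j = 0 := by omega
      rfl
    | succ n =>
      obtain ⟨i, hi⟩ := ih (fun j => d (j + 1))
      refine ⟨Nat.pair (d 0) i, fun j hj => ?_⟩
      cases j with
      | zero => simp [tupleEntry]
      | succ j => simpa [tupleEntry] using hi j (by omega)

theorem theta_surjective (n : ℕ) : Function.Surjective (theta n) := by
  rintro ⟨A, hA⟩
  let a : ℕ → ℕ := fun k => if h : k < n then A.orderEmbOfFin hA ⟨k, h⟩ else 0
  have ha : ∀ k, k + 1 < n → a k < a (k + 1) := by
    intro k hk
    have hk' : k < n := by omega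
    simp only [a, hk, hk', dif_pos]
    exact (A.orderEmbOfFin hA).strictMono (by simp)
  obtain ⟨i, hi⟩ := exists_tupleEntry n
    (fun j => if j = 0 then a 0 else a j - a (j - 1) - 1)
  have key : ∀ k < n, k + ∑ j ∈ Finset.range (k + 1), tupleEntry n i j = a k := by
    intro k
    induction k with
    | zero => intro h; simp [hi 0 h]
    | succ k ih =>
      intro h
      have h1 := ih (by omega)
      have h2 := ha k h
      rw [Finset.sum_range_succ, hi (k + 1) h]
      simp only [Nat.add_eq_zero_iff, one_ne_zero, and_false, if_false, Nat.add_sub_cancel]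
      omega
  refine ⟨i, Subtype.ext ?_⟩
  ext x
  simp only [theta, Finset.mem_image, Finset.mem_range]
  constructor
  · rintro ⟨k, hk, rfl⟩
    rw [key k hk]
    simp only [a, hk, dif_pos]
    exact A.orderEmbOfFin_mem hA _
  · intro hx
    have : x ∈ Set.range (A.orderEmbOfFin hA) := by simpa using hx
    obtain ⟨⟨k, hk⟩, rfl⟩ := this
    exact ⟨k, hk, by rw [key k hk]; simp [a, hk]⟩

/-! ### Colorings and Ramsey's theorem -/

/-- The set `𝒞_{n,k}` of colorings. For a natural number `k` these are the maps
`c : [ℕ]ⁿ → {0, …, k - 1}`; for `k = ⊤`, which stands for `k = ℕ`, these are the maps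
`c : [ℕ]ⁿ → ℕ` with finite range. -/
abbrev Coloring (n : ℕ) (k : ℕ∞) : Type :=
  {c : NSubset n → ℕ // (∀ A, (c A : ℕ∞) < k) ∧ (Set.range c).Finite}

/-- The point `p` of Baire space is a name of the coloring `c` if `p i = c (ϑₙ i)` for all `i`. -/
instance (n : ℕ) (k : ℕ∞) : RepresentedSpace (Coloring n k) where
  Names p c := ∀ i, p i = c.1 (theta n i)
  names_unique := by
    intro p c d hc hd
    apply Subtype.ext
    funext A
    obtain ⟨i, rfl⟩ := theta_surjective n A
    rw [← hc i, ← hd i]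
  exists_name c := ⟨fun i => c.1 (theta n i), fun _ => rfl⟩

/-- The set `ℋ_c` of infinite homogeneous sets of the coloring `c`. -/
def homogeneousSets {n : ℕ} {k : ℕ∞} (c : Coloring n k) : Set (Set ℕ) :=
  {M | M.Infinite ∧ ∃ a, ∀ A : NSubset n, (A.1 : Set ℕ) ⊆ M → c.1 A = a}

/-- The coloring `c` is stable: `lim_{i → ∞} c (A ∪ {i})` exists for all `A ∈ [ℕ]ⁿ⁻¹`. -/
def IsStableColoring {n : ℕ} {k : ℕ∞} (c : Coloring n k) : Prop :=
  ∀ A : Finset ℕ, A.card + 1 = n →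
    ∃ a, ∀ᶠ i in Filter.atTop, ∀ h : (insert i A).card = n, c.1 ⟨insert i A, h⟩ = a

/-- Ramsey's theorem `RT_{n,k}`: given a coloring, find an infinite homogeneous set. -/
def RT (n : ℕ) (k : ℕ∞) : Problem (Coloring n k) (Set ℕ) where
  dom := Set.univ
  sol c := homogeneousSets c

/-- The stable Ramsey theorem `SRT_{n,k}`: the restriction of `RT_{n,k}` to stable colorings. -/
def SRT (n : ℕ) (k : ℕ∞) : Problem (Coloring n k) (Set ℕ) where
  dom := {c | IsStableColoring c}
  sol c := homogeneousSets c

/-! ### Primitive recursive functions and predicates -/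

attribute [fun_prop] Primrec
attribute [fun_prop] Primrec.id Primrec.const Primrec.comp Primrec.fst Primrec.snd Primrec.pair

section PrimrecHelpers

variable {α β γ : Type} [Primcodable α] [Primcodable β] [Primcodable γ]

@[fun_prop]
theorem Primrec.fun_append {f g : α → List β} (hf : Primrec f) (hg : Primrec g) :
    Primrec fun a => f a ++ g a := Primrec.list_append.comp hf hg

@[fun_prop]
theorem Primrec.fun_cons {f : α → β} {g : α → List β} (hf : Primrec f) (hg : Primrec g) :
    Primrec fun a => f a :: g a := Primrec.list_cons.comp hf hg

@[fun_prop]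
theorem Primrec.fun_length {g : α → List β} (hg : Primrec g) :
    Primrec fun a => (g a).length := Primrec.list_length.comp hg

@[fun_prop]
theorem Primrec.fun_map {f : α → List β} {g : α → β → γ} (hf : Primrec f)
    (hg : Primrec fun p : α × β => g p.1 p.2) : Primrec fun a => (f a).map (g a) :=
  Primrec.list_map hf hg

@[fun_prop]
theorem Primrec.fun_range {f : α → ℕ} (hf : Primrec f) :
    Primrec fun a => List.range (f a) := Primrec.list_range.comp hf

@[fun_prop]
theorem Primrec.fun_take {f : α → ℕ} {g : α → List β} (hf : Primrec f) (hg : Primrec g) :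
    Primrec fun a => (g a).take (f a) := Primrec.list_take.comp hf hg

@[fun_prop]
theorem Primrec.fun_tail {g : α → List β} (hg : Primrec g) :
    Primrec fun a => (g a).tail := Primrec.list_tail.comp hg

@[fun_prop]
theorem Primrec.fun_headI [Inhabited β] {g : α → List β} (hg : Primrec g) :
    Primrec fun a => (g a).headI := Primrec.list_headI.comp hg

@[fun_prop]
theorem Primrec.fun_getD {f : α → List β} {g : α → ℕ} (d : β) (hf : Primrec f)
    (hg : Primrec g) : Primrec fun a => (f a).getD (g a) d := (Primrec.list_getD d).comp hf hg

@[fun_prop]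
theorem Primrec.fun_add {f g : α → ℕ} (hf : Primrec f) (hg : Primrec g) :
    Primrec fun a => f a + g a := Primrec.nat_add.comp hf hg

@[fun_prop]
theorem Primrec.fun_sub {f g : α → ℕ} (hf : Primrec f) (hg : Primrec g) :
    Primrec fun a => f a - g a := Primrec.nat_sub.comp hf hg

@[fun_prop]
theorem Primrec.fun_natPair {f g : α → ℕ} (hf : Primrec f) (hg : Primrec g) :
    Primrec fun a => Nat.pair (f a) (g a) := Primrec₂.natPair.comp hf hg

@[fun_prop]
theorem Primrec.fun_unpair {f : α → ℕ} (hf : Primrec f) :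
    Primrec fun a => Nat.unpair (f a) := Primrec.unpair.comp hf

@[fun_prop]
theorem Primrec.fun_encode {f : α → β} (hf : Primrec f) :
    Primrec fun a => Encodable.encode (f a) := Primrec.encode.comp hf

/-- Decoding with a default value. -/
def decodeD (β : Type) [Encodable β] [Inhabited β] (k : ℕ) : β :=
  (Encodable.decode k : Option β).getD default

@[simp]
theorem decodeD_encode [Inhabited β] (b : β) : decodeD β (Encodable.encode b) = b := by
  simp [decodeD]

@[fun_prop]
theorem Primrec.fun_decodeD [Inhabited β] {f : α → ℕ} (hf : Primrec f) :
    Primrec fun a => decodeD β (f a) :=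
  Primrec.option_getD_default.comp (Primrec.decode.comp hf)

theorem PrimrecPred.fun_exists_lt {N : α → ℕ} {R : α → ℕ → Prop} (hN : Primrec N)
    (hR : PrimrecPred fun p : α × ℕ => R p.1 p.2) : PrimrecPred fun a => ∃ k < N a, R a k :=
  ((PrimrecRel.exists_mem_list (R := fun k a => R a k)
    (hR.comp (Primrec.pair Primrec.snd Primrec.fst))).comp (Primrec.fun_range hN)
    Primrec.id).of_eq fun a => by simp

theorem PrimrecPred.fun_forall_lt {N : α → ℕ} {R : α → ℕ → Prop} (hN : Primrec N)
    (hR : PrimrecPred fun p : α × ℕ => R p.1 p.2) : PrimrecPred fun a => ∀ k < N a, R a k :=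
  ((PrimrecRel.forall_mem_list (R := fun k a => R a k)
    (hR.comp (Primrec.pair Primrec.snd Primrec.fst))).comp (Primrec.fun_range hN)
    Primrec.id).of_eq fun a => by simp

theorem PrimrecPred.fun_eq {f g : α → β} (hf : Primrec f) (hg : Primrec g) :
    PrimrecPred fun a => f a = g a := Primrec.eq.comp hf hg

theorem PrimrecPred.fun_lt {f g : α → ℕ} (hf : Primrec f) (hg : Primrec g) :
    PrimrecPred fun a => f a < g a := Primrec.nat_lt.comp hf hg

theorem PrimrecPred.fun_le {f g : α → ℕ} (hf : Primrec f) (hg : Primrec g) :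
    PrimrecPred fun a => f a ≤ g a := Primrec.nat_le.comp hf hg

end PrimrecHelpers

/-! ### Prefixes -/

namespace Baire

@[simp]
theorem length_prefixList (x : Baire) (m : ℕ) : (x.prefixList m).length = m := by
  simp [prefixList]

theorem take_prefixList (x : Baire) {k m : ℕ} (h : k ≤ m) :
    (x.prefixList m).take k = x.prefixList k := by
  simp [prefixList, ← List.map_take, List.take_range, h]

theorem getD_prefixList (x : Baire) {k m : ℕ} (h : k < m) (d : ℕ) :
    (x.prefixList m).getD k d = x k := by
  simp [prefixList, List.getD_eq_getElem?_getD, List.getElem?_map, List.getElem?_range h]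

theorem prefixList_succ (x : Baire) (m : ℕ) : x.prefixList (m + 1) = x.prefixList m ++ [x m] := by
  simp [prefixList, List.range_succ]

theorem prefixList_eq_iff (x : Baire) (w : List ℕ) :
    x.prefixList w.length = w ↔ ∀ k < w.length, x k = w.getD k 0 := by
  constructor
  · intro h k hk
    rw [← h, getD_prefixList]
    exact hk
  · intro h
    refine List.ext_getElem (by simp) fun k hk hk' => ?_
    simp only [prefixList, List.getElem_map, List.getElem_range]
    rw [h k hk', List.getD_eq_getElem _ _ hk']

end Baire

/-! ### Effective families of finite Borel rank -/

/-- `EffSigma D m S` says that the family `S` of subsets of Baire space is, on the set `D`,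
uniformly effectively `𝚺⁰ₘ₊₁`. -/
def EffSigma (D : Set Baire) : ℕ → ∀ {α : Type} [Primcodable α], (α → Baire → Prop) → Prop
  | 0, α, _, S => ∃ R : α × List ℕ → Prop, PrimrecPred R ∧
      ∀ a, ∀ x ∈ D, S a x ↔ ∃ m, R (a, x.prefixList m)
  | m + 1, α, _, S => ∃ T : α × ℕ → Baire → Prop, EffSigma D m T ∧
      ∀ a, ∀ x ∈ D, S a x ↔ ∃ j, ¬ T (a, j) x

namespace EffSigma

variable {D : Set Baire} {α β : Type} [Primcodable α] [Primcodable β] {m : ℕ}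
  {S T : α → Baire → Prop}

theorem congr (h : EffSigma D m S) (hST : ∀ a, ∀ x ∈ D, T a x ↔ S a x) : EffSigma D m T := by
  cases m with
  | zero =>
    obtain ⟨R, hR, h⟩ := h
    exact ⟨R, hR, fun a x hx => (hST a x hx).trans (h a x hx)⟩
  | succ m =>
    obtain ⟨R, hR, h⟩ := h
    exact ⟨R, hR, fun a x hx => (hST a x hx).trans (h a x hx)⟩

theorem comp {S : β → Baire → Prop} (h : EffSigma D m S) {f : α → β} (hf : Primrec f) :
    EffSigma D m fun a => S (f a) := by
  induction m generalizing α β with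
  | zero =>
    obtain ⟨R, hR, h⟩ := h
    exact ⟨fun p => R (f p.1, p.2), hR.comp (by fun_prop), fun a x hx => h (f a) x hx⟩
  | succ m ih =>
    obtain ⟨R, hR, h⟩ := h
    exact ⟨fun p => R (f p.1, p.2), ih (f := fun p : α × ℕ => (f p.1, p.2)) hR (by fun_prop),
      fun a x hx => h (f a) x hx⟩

/-- A kernel of an effectively open family may be taken to be monotone. -/
theorem exists_monotone_kernel (h : EffSigma D 0 S) : ∃ R : α × List ℕ → Prop, PrimrecPred R ∧
    (∀ a, ∀ x ∈ D, S a x ↔ ∃ m, R (a, x.prefixList m)) ∧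
    ∀ a (x : Baire) k l, k ≤ l → R (a, x.prefixList k) → R (a, x.prefixList l) := by
  obtain ⟨R, hR, h⟩ := h
  refine ⟨fun p => ∃ k < p.2.length + 1, R (p.1, p.2.take k), ?_, fun a x hx => ?_, ?_⟩
  · exact PrimrecPred.fun_exists_lt (by fun_prop) (hR.comp (by fun_prop))
  · rw [h a x hx]
    constructor
    · rintro ⟨k, hk⟩
      exact ⟨k, k, by simp, by simpa [Baire.take_prefixList] using hk⟩
    · rintro ⟨k, l, hl, hk⟩
      refine ⟨l, ?_⟩
      simp only [Baire.length_prefixList] at hl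
      rwa [Baire.take_prefixList _ (by omega)] at hk
  · rintro a x k l hkl ⟨i, hi, hik⟩
    simp only [Baire.length_prefixList] at hi
    refine ⟨i, by simp; omega, ?_⟩
    rw [Baire.take_prefixList _ (by omega)] at hik ⊢
    exact hik

theorem and_or (m : ℕ) : ∀ {α : Type} [Primcodable α] {S T : α → Baire → Prop},
    EffSigma D m S → EffSigma D m T →
    EffSigma D m (fun a x => S a x ∧ T a x) ∧ EffSigma D m (fun a x => S a x ∨ T a x) := by
  induction m with
  | zero =>
    intro α _ S T hS hT
    obtain ⟨R, hR, h, hm⟩ := hS.exists_monotone_kernel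
    obtain ⟨R', hR', h', hm'⟩ := hT.exists_monotone_kernel
    refine ⟨⟨_, hR.and hR', fun a x hx => ?_⟩, ⟨_, hR.or hR', fun a x hx => ?_⟩⟩
    · dsimp only
      rw [h a x hx, h' a x hx]
      constructor
      · rintro ⟨⟨k, hk⟩, l, hl⟩
        exact ⟨max k l, hm a x k _ (le_max_left _ _) hk, hm' a x l _ (le_max_right _ _) hl⟩
      · rintro ⟨k, hk, hl⟩
        exact ⟨⟨k, hk⟩, k, hl⟩
    · dsimp only
      rw [h a x hx, h' a x hx, exists_or]
  | succ m ih =>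
    intro α _ S T hS hT
    obtain ⟨R, hR, h⟩ := hS
    obtain ⟨R', hR', h'⟩ := hT
    have e := hR.comp (f := fun p : α × ℕ => (p.1, p.2.unpair.1)) (by fun_prop)
    have e' := hR'.comp (f := fun p : α × ℕ => (p.1, p.2.unpair.2)) (by fun_prop)
    refine ⟨⟨_, (ih e e').2, fun a x hx => ?_⟩, ⟨_, (ih e e').1, fun a x hx => ?_⟩⟩
    · dsimp only
      rw [h a x hx, h' a x hx]
      constructor
      · rintro ⟨⟨k, hk⟩, l, hl⟩
        exact ⟨Nat.pair k l, by simp [hk, hl]⟩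
      · rintro ⟨k, hk⟩
        rw [not_or] at hk
        exact ⟨⟨_, hk.1⟩, _, hk.2⟩
    · dsimp only
      rw [h a x hx, h' a x hx]
      constructor
      · rintro (⟨k, hk⟩ | ⟨k, hk⟩) <;> exact ⟨Nat.pair k k, by simp [hk]⟩
      · rintro ⟨k, hk⟩
        rw [not_and_or] at hk
        exact hk.imp (fun h => ⟨_, h⟩) (fun h => ⟨_, h⟩)

theorem and (hS : EffSigma D m S) (hT : EffSigma D m T) :
    EffSigma D m fun a x => S a x ∧ T a x := (and_or m hS hT).1

theorem or (hS : EffSigma D m S) (hT : EffSigma D m T) :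
    EffSigma D m fun a x => S a x ∨ T a x := (and_or m hS hT).2

theorem exist [Inhabited β] {S : α → β → Baire → Prop}
    (h : EffSigma D m fun (p : α × β) x => S p.1 p.2 x) :
    EffSigma D m fun a x => ∃ b, S a b x := by
  cases m with
  | zero =>
    obtain ⟨R, hR, h⟩ := h
    refine ⟨fun p => R ((p.1, decodeD β p.2.length.unpair.1), p.2.take p.2.length.unpair.2),
      hR.comp (by fun_prop), fun a x hx => ?_⟩
    constructor
    · rintro ⟨b, hb⟩
      obtain ⟨k, hk⟩ := (h (a, b) x hx).1 hb
      refine ⟨Nat.pair (Encodable.encode b) k, ?_⟩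
      simpa [Baire.take_prefixList _ (Nat.right_le_pair _ _)] using hk
    · rintro ⟨k, hk⟩
      rw [Baire.length_prefixList, Baire.take_prefixList _ (Nat.unpair_right_le _)] at hk
      exact ⟨_, (h (a, _) x hx).2 ⟨_, hk⟩⟩
  | succ m =>
    obtain ⟨R, hR, h⟩ := h
    refine ⟨fun p => R ((p.1, decodeD β p.2.unpair.1), p.2.unpair.2),
      hR.comp (f := fun p : α × ℕ => ((p.1, decodeD β p.2.unpair.1), p.2.unpair.2))
        (by fun_prop), fun a x hx => ?_⟩
    constructor
    · rintro ⟨b, hb⟩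
      obtain ⟨k, hk⟩ := (h (a, b) x hx).1 hb
      exact ⟨Nat.pair (Encodable.encode b) k, by simpa using hk⟩
    · rintro ⟨k, hk⟩
      exact ⟨_, (h (a, _) x hx).2 ⟨_, hk⟩⟩

theorem of_primrecPred {R : α → Prop} (hR : PrimrecPred R) :
    EffSigma D m fun a _ => R a := by
  induction m generalizing α with
  | zero => exact ⟨fun p => R p.1, hR.comp (by fun_prop), fun a x _ => by simp⟩
  | succ m ih =>
    exact ⟨fun p _ => ¬ R p.1, ih (hR.not.comp (by fun_prop)), fun a x _ => by simp⟩

theorem not (h : EffSigma D m S) : EffSigma D (m + 1) fun a x => ¬ S a x :=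
  ⟨fun p => S p.1, h.comp (by fun_prop), fun a x _ => by simp⟩

theorem succ (h : EffSigma D m S) : EffSigma D (m + 1) S := by
  induction m generalizing α with
  | zero =>
    obtain ⟨R, hR, h⟩ := h
    refine ⟨fun p x => ¬ R (p.1, x.prefixList p.2),
      ⟨fun p => p.2.length = p.1.2 ∧ ¬ R (p.1.1, p.2),
        (PrimrecPred.fun_eq (by fun_prop) (by fun_prop)).and (hR.not.comp (by fun_prop)),
        fun p x _ => ?_⟩, fun a x hx => ?_⟩
    · simp
    · simp [h a x hx]
  | succ m ih =>
    obtain ⟨R, hR, h⟩ := h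
    exact ⟨R, ih hR, h⟩

theorem mono (h : EffSigma D m S) {l : ℕ} (hl : m ≤ l) : EffSigma D l S := by
  induction hl with
  | refl => exact h
  | step _ ih => exact ih.succ

/-- Predicates that evaluate the point at one place. -/
theorem eval {f : α → ℕ} (hf : Primrec f) {R : α × ℕ → Prop} (hR : PrimrecPred R) :
    EffSigma D m fun a x => R (a, x (f a)) := by
  refine mono (m := 0) ?_ (Nat.zero_le _)
  refine ⟨fun p => f p.1 < p.2.length ∧ R (p.1, p.2.getD (f p.1) 0),
    (PrimrecPred.fun_lt (by fun_prop) (by fun_prop)).and (hR.comp (by fun_prop)), fun a x _ => ?_⟩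
  constructor
  · intro h
    exact ⟨f a + 1, by simp, by rwa [Baire.getD_prefixList _ (by simp)]⟩
  · rintro ⟨k, hk, h⟩
    rw [Baire.length_prefixList] at hk
    rwa [Baire.getD_prefixList _ hk] at h

theorem forall_lt {N : α → ℕ} (hN : Primrec N) {S : α → ℕ → Baire → Prop}
    (h : EffSigma D m fun (p : α × ℕ) x => S p.1 p.2 x) :
    EffSigma D m fun a x => ∀ k < N a, S a k x := by
  cases m with
  | zero =>
    obtain ⟨R, hR, h, hm⟩ := h.exists_monotone_kernel
    refine ⟨fun p => ∀ k < N p.1, R ((p.1, k), p.2),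
      PrimrecPred.fun_forall_lt (by fun_prop) (hR.comp (by fun_prop)), fun a x hx => ?_⟩
    constructor
    · intro H
      have H' : ∀ k, ∃ l, k < N a → R ((a, k), x.prefixList l) := by
        intro k
        by_cases hk : k < N a
        · obtain ⟨l, hl⟩ := (h (a, k) x hx).1 (H k hk)
          exact ⟨l, fun _ => hl⟩
        · exact ⟨0, fun h => absurd h hk⟩
      choose l hl using H'
      exact ⟨(Finset.range (N a)).sup l, fun k hk =>
        hm _ _ _ _ (Finset.le_sup (Finset.mem_range.2 hk)) (hl k hk)⟩
    · rintro ⟨l, hl⟩ k hk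
      exact (h (a, k) x hx).2 ⟨l, hl k hk⟩
  | succ m =>
    obtain ⟨T, hT, h⟩ := h
    have e1 : EffSigma D m fun (p : (α × ℕ) × ℕ) x => p.2 < N p.1.1 ∧
        T ((p.1.1, p.2), (decodeD (List ℕ) p.1.2).getD p.2 0) x :=
      (of_primrecPred (PrimrecPred.fun_lt (by fun_prop) (by fun_prop))).and
        (hT.comp (f := fun p : (α × ℕ) × ℕ =>
          ((p.1.1, p.2), (decodeD (List ℕ) p.1.2).getD p.2 0)) (by fun_prop))
    refine ⟨_, exist (S := fun (q : α × ℕ) k x => k < N q.1 ∧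
      T ((q.1, k), (decodeD (List ℕ) q.2).getD k 0) x) e1, fun a x hx => ?_⟩
    constructor
    · intro H
      have H' : ∀ k, ∃ l, k < N a → ¬ T ((a, k), l) x := by
        intro k
        by_cases hk : k < N a
        · obtain ⟨l, hl⟩ := (h (a, k) x hx).1 (H k hk)
          exact ⟨l, fun _ => hl⟩
        · exact ⟨0, fun h => absurd h hk⟩
      choose l hl using H'
      refine ⟨Encodable.encode (Baire.prefixList l (N a)), ?_⟩
      rintro ⟨k, hk, hk'⟩
      rw [decodeD_encode, Baire.getD_prefixList _ hk] at hk'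
      exact hl k hk hk'
    · rintro ⟨l, hl⟩ k hk
      exact (h (a, k) x hx).2 ⟨_, fun h => hl ⟨k, hk, h⟩⟩

theorem exists_lt {N : α → ℕ} (hN : Primrec N) {S : α → ℕ → Baire → Prop}
    (h : EffSigma D m fun (p : α × ℕ) x => S p.1 p.2 x) :
    EffSigma D m fun a x => ∃ k < N a, S a k x :=
  exist (S := fun a k x => k < N a ∧ S a k x)
    ((of_primrecPred (PrimrecPred.fun_lt (by fun_prop) (by fun_prop))).and h)

theorem forall_mem [Inhabited β] {L : α → List β} (hL : Primrec L) {S : α → β → Baire → Prop}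
    (h : EffSigma D m fun (p : α × β) x => S p.1 p.2 x) :
    EffSigma D m fun a x => ∀ b ∈ L a, S a b x := by
  refine (forall_lt (N := fun a => (L a).length) (by fun_prop)
    (S := fun a k x => S a ((L a).getD k default) x)
    (h.comp (f := fun p : α × ℕ => (p.1, (L p.1).getD p.2 default)) (by fun_prop))).congr ?_
  intro a x _
  rw [List.forall_mem_iff_getElem]
  refine forall₂_congr fun k hk => ?_
  rw [List.getD_eq_getElem _ _ hk]

theorem exists_mem [Inhabited β] {L : α → List β} (hL : Primrec L) {S : α → β → Baire → Prop}
    (h : EffSigma D m fun (p : α × β) x => S p.1 p.2 x) :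
    EffSigma D m fun a x => ∃ b ∈ L a, S a b x := by
  refine (exists_lt (N := fun a => (L a).length) (by fun_prop)
    (S := fun a k x => S a ((L a).getD k default) x)
    (h.comp (f := fun p : α × ℕ => (p.1, (L p.1).getD p.2 default)) (by fun_prop))).congr ?_
  intro a x _
  rw [List.exists_mem_iff_getElem]
  refine exists_congr fun k => ?_
  constructor
  · rintro ⟨hk, h⟩
    exact ⟨hk, by rwa [List.getD_eq_getElem _ _ hk]⟩
  · rintro ⟨hk, h⟩
    exact ⟨hk, by rwa [List.getD_eq_getElem _ _ hk] at h⟩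

end EffSigma

/-! ### Substitution -/

namespace EffSigma

variable {D D' : Set Baire} {α : Type} [Primcodable α] {m : ℕ} {S : α → Baire → Prop}

theorem forall_getD_eq {Ψ : Baire → Baire}
    (hΨ : EffSigma D m fun (p : ℕ × ℕ) x => Ψ x p.1 = p.2) :
    EffSigma D m fun (w : List ℕ) x => ∀ k < w.length, Ψ x k = w.getD k 0 :=
  forall_lt (N := fun w : List ℕ => w.length) (S := fun w k x => Ψ x k = w.getD k 0) (by fun_prop)
    (hΨ.comp (f := fun p : List ℕ × ℕ => (p.2, p.1.getD p.2 0)) (by fun_prop))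

/-- Pulling back an effectively open family along a map with effectively `𝚺⁰ₘ₊₁` graph. -/
theorem subst_open {Ψ : Baire → Baire}
    (hΨ : EffSigma D m fun (p : ℕ × ℕ) x => Ψ x p.1 = p.2) (hD : Set.MapsTo Ψ D D')
    (h : EffSigma D' 0 S) : EffSigma D m fun a x => S a (Ψ x) := by
  obtain ⟨R, hR, h⟩ := h
  refine (exist (S := fun a (w : List ℕ) x => R (a, w) ∧ ∀ k < w.length, Ψ x k = w.getD k 0)
    ((of_primrecPred (hR.comp (by fun_prop))).and
      (hΨ.forall_getD_eq.comp (f := fun p : α × List ℕ => p.2) (by fun_prop)))).congr ?_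
  intro a x hx
  rw [h a _ (hD hx)]
  constructor
  · rintro ⟨k, hk⟩
    refine ⟨_, hk, fun i hi => ?_⟩
    rw [Baire.length_prefixList] at hi
    rw [Baire.getD_prefixList _ hi]
  · rintro ⟨w, hw, h⟩
    rw [← Baire.prefixList_eq_iff] at h
    exact ⟨w.length, by rwa [h]⟩

theorem subst {Ψ : Baire → Baire}
    (hΨ : EffSigma D 0 fun (p : ℕ × ℕ) x => Ψ x p.1 = p.2) (hD : Set.MapsTo Ψ D D')
    (h : EffSigma D' m S) : EffSigma D m fun a x => S a (Ψ x) := by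
  induction m generalizing α with
  | zero => exact subst_open hΨ hD h
  | succ m ih =>
    obtain ⟨T, hT, h⟩ := h
    exact ⟨fun p x => T p (Ψ x), ih hT, fun a x hx => h a _ (hD hx)⟩

/-- The family `S` is determined by one effectively open family `T`, and pulling `S` back along a
map raises its level by at most one if pulling back `T` yields a `𝚫⁰₃` family. -/
theorem exists_open_kernel (h : EffSigma D' (m + 1) S) :
    ∃ (β : Type) (_ : Primcodable β) (_ : Inhabited β) (T : β → Baire → Prop), EffSigma D' 0 T ∧
      ∀ (D : Set Baire) (Ψ : Baire → Baire), Set.MapsTo Ψ D D' →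
        EffSigma D 2 (fun b x => T b (Ψ x)) → EffSigma D 2 (fun b x => ¬ T b (Ψ x)) →
        EffSigma D (m + 2) fun a x => S a (Ψ x) := by
  by_cases hα : IsEmpty α
  · refine ⟨ℕ, inferInstance, inferInstance, fun _ _ => True,
      of_primrecPred ⟨fun _ => isTrue trivial, Primrec.const true⟩, fun D Ψ _ _ _ => ?_⟩
    exact (of_primrecPred (R := fun _ => True)
      ⟨fun _ => isTrue trivial, Primrec.const true⟩).congr fun a => isEmptyElim a
  rw [not_isEmpty_iff] at hα
  induction m generalizing α with
  | zero =>
    obtain ⟨T, hT, h⟩ := h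
    refine ⟨α × ℕ, inferInstance, ⟨(hα.some, 0)⟩, T, hT, fun D Ψ hD _ h2 => ?_⟩
    exact (exist (S := fun a j x => ¬ T (a, j) (Ψ x)) h2).congr fun a x hx => h a _ (hD hx)
  | succ m ih =>
    obtain ⟨T, hT, h⟩ := h
    obtain ⟨β, i1, i2, T', hT', H⟩ := ih hT inferInstance
    exact ⟨β, i1, i2, T', hT', fun D Ψ hD h1 h2 =>
      ⟨fun p x => T p (Ψ x), H D Ψ hD h1 h2, fun a x hx => h a _ (hD hx)⟩⟩

end EffSigma

/-! ### A low basis theorem -/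

/-- The pair of two points of Baire space, with `(x, y) k = ⟨x k, y k⟩`. -/
def Baire.join (x y : Baire) : Baire := fun k => Nat.pair (x k) (y k)

namespace LowBasis

/-- The word `τ` belongs to the tree with one-step extension relation `Q`. -/
def InTree (Q : List ℕ × ℕ → Prop) (τ : List ℕ) : Prop :=
  ∀ i < τ.length, Q (τ.take i, τ.getD i 0)

/-- The prefix of length `m` of the pair of (an infinite continuation of) `τ` and `C`. -/
def joinPrefix (τ : List ℕ) (C : Baire) (m : ℕ) : List ℕ :=
  (List.range m).map fun k => Nat.pair (τ.getD k 0) (C k)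

/-- No initial segment of `τ` forces the open condition with number `e`. -/
def Avoids (R : ℕ × List ℕ → Prop) (C : Baire) (τ : List ℕ) (e : ℕ) : Prop :=
  ∀ m < τ.length + 1, ¬ R (e, joinPrefix τ C m)

/-- There are arbitrarily long words of the tree that extend `σ` and avoid the conditions in
`B`. -/
def Alive (Q : List ℕ × ℕ → Baire → Prop) (R : ℕ × List ℕ → Prop) (C : Baire)
    (q : List ℕ × List ℕ) : Prop :=
  ∀ N, ∃ ρ : List ℕ, N ≤ ρ.length ∧ InTree (Q · C) (q.1 ++ ρ) ∧ ∀ e ∈ q.2, Avoids R C (q.1 ++ ρ) e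

theorem InTree.of_append {Q : List ℕ × ℕ → Prop} {σ ρ : List ℕ} (h : InTree Q (σ ++ ρ)) :
    InTree Q σ := by
  intro i hi
  have := h i (by simp; omega)
  rwa [List.take_append_of_le_length hi.le, List.getD_append _ _ _ _ hi] at this

theorem inTree_concat {Q : List ℕ × ℕ → Prop} {σ : List ℕ} {a : ℕ} :
    InTree Q (σ ++ [a]) ↔ InTree Q σ ∧ Q (σ, a) := by
  constructor
  · intro h
    refine ⟨h.of_append, ?_⟩
    have := h σ.length (by simp)
    simpa using this
  · rintro ⟨h, h'⟩ i hi
    rcases Nat.lt_succ_iff_lt_or_eq.1 (by simpa using hi) with hi | rfl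
    · have := h i hi
      rwa [List.take_append_of_le_length hi.le, List.getD_append _ _ _ _ hi]
    · simpa using h'

theorem joinPrefix_append {σ ρ : List ℕ} {C : Baire} {m : ℕ} (h : m ≤ σ.length) :
    joinPrefix (σ ++ ρ) C m = joinPrefix σ C m := by
  refine List.map_congr_left fun k hk => ?_
  rw [List.mem_range] at hk
  rw [List.getD_append _ _ _ _ (by omega)]

theorem joinPrefix_prefixList {P C : Baire} {m k : ℕ} (h : m ≤ k) :
    joinPrefix (P.prefixList k) C m = (Baire.join P C).prefixList m := by
  refine List.map_congr_left fun i hi => ?_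
  rw [List.mem_range] at hi
  rw [Baire.getD_prefixList _ (by omega)]
  rfl

theorem Avoids.of_append {R : ℕ × List ℕ → Prop} {C : Baire} {σ ρ : List ℕ} {e : ℕ}
    (h : Avoids R C (σ ++ ρ) e) : Avoids R C σ e := by
  intro m hm
  rw [← joinPrefix_append (ρ := ρ) (by omega)]
  exact h m (by simp; omega)

theorem Alive.exists_concat {Q : List ℕ × ℕ → Baire → Prop} {R : ℕ × List ℕ → Prop} {C : Baire}
    {σ B : List ℕ} (hQ : {a | Q (σ, a) C}.Finite) (h : Alive Q R C (σ, B)) :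
    ∃ a, Alive Q R C (σ ++ [a], B) := by
  by_contra! H
  simp only [Alive] at H
  push Not at H
  choose N hN using H
  obtain ⟨ρ, hρ, hT, hB⟩ := h (hQ.toFinset.sup N + 1)
  cases ρ with
  | nil => simp at hρ
  | cons a ρ =>
    have e : σ ++ a :: ρ = (σ ++ [a]) ++ ρ := by simp
    simp only [e] at hT hB
    have ha : Q (σ, a) C := (inTree_concat.1 hT.of_append).2
    have h1 : N a ≤ hQ.toFinset.sup N := Finset.le_sup (f := N) (by simpa using ha)
    obtain ⟨e, he, he'⟩ := hN a ρ
      (h1.trans (by simpa only [List.length_cons, Nat.add_le_add_iff_right] using hρ)) hT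
    exact he' (hB e he)

open Classical in
/-- One step of the construction: decide the next condition, then extend the word. -/
noncomputable def step (Q : List ℕ × ℕ → Baire → Prop) (R : ℕ × List ℕ → Prop) (C : Baire)
    (q : List ℕ × List ℕ) : List ℕ × List ℕ :=
  let B := if Alive Q R C (q.1, q.1.length :: q.2) then q.1.length :: q.2 else q.2
  (q.1 ++ [sInf {a | Alive Q R C (q.1 ++ [a], B)}], B)

/-- The stages of the construction. -/
noncomputable def stage (Q : List ℕ × ℕ → Baire → Prop) (R : ℕ × List ℕ → Prop) (C : Baire) :
    ℕ → List ℕ × List ℕ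
  | 0 => ([], [])
  | k + 1 => step Q R C (stage Q R C k)

/-- The path through the tree defined by the construction. -/
noncomputable def path (Q : List ℕ × ℕ → Baire → Prop) (R : ℕ × List ℕ → Prop) (C : Baire) :
    Baire := fun k => (stage Q R C (k + 1)).1.getD k 0

/-- A relation that describes one step of the construction on states that are alive. -/
def StepRel (Q : List ℕ × ℕ → Baire → Prop) (R : ℕ × List ℕ → Prop) (C : Baire)
    (q q' : List ℕ × List ℕ) : Prop :=
  (Alive Q R C (q.1, q.1.length :: q.2) ∧ q'.2 = q.1.length :: q.2 ∨
    ¬ Alive Q R C (q.1, q.1.length :: q.2) ∧ q'.2 = q.2) ∧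
  q'.1 = q.1 ++ [q'.1.getD q.1.length 0] ∧ Alive Q R C q' ∧
  ∀ a < q'.1.getD q.1.length 0, ¬ Alive Q R C (q.1 ++ [a], q'.2)

section

variable {Q : List ℕ × ℕ → Baire → Prop} {R : ℕ × List ℕ → Prop} {C : Baire}

theorem stepRel_step (hQ : ∀ σ, {a | Q (σ, a) C}.Finite) {q : List ℕ × List ℕ}
    (h : Alive Q R C q) : StepRel Q R C q (step Q R C q) := by
  classical
  have hB : Alive Q R C (q.1, (step Q R C q).2) := by
    by_cases h' : Alive Q R C (q.1, q.1.length :: q.2)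
    · simp [step, h']
    · simpa [step, h'] using h
  have hn := (hB.exists_concat (hQ _) : ∃ a, _)
  have hmem : sInf {a | Alive Q R C (q.1 ++ [a], (step Q R C q).2)} ∈
    {a | Alive Q R C (q.1 ++ [a], (step Q R C q).2)} := Nat.sInf_mem hn
  have h1 : (step Q R C q).1 =
    q.1 ++ [sInf {a | Alive Q R C (q.1 ++ [a], (step Q R C q).2)}] := rfl
  have h2 : (step Q R C q).1.getD q.1.length 0 =
      sInf {a | Alive Q R C (q.1 ++ [a], (step Q R C q).2)} := by
    rw [h1]; simp
  refine ⟨?_, ?_, ?_, ?_⟩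
  · by_cases h' : Alive Q R C (q.1, q.1.length :: q.2)
    · exact Or.inl ⟨h', by simp [step, h']⟩
    · exact Or.inr ⟨h', by simp [step, h']⟩
  · rw [h2, h1]
  · exact hmem
  · intro a ha
    rw [h2] at ha
    exact Nat.notMem_of_lt_sInf ha

theorem StepRel.eq_step {q q' : List ℕ × List ℕ} (h : StepRel Q R C q q') :
    q' = step Q R C q := by
  classical
  obtain ⟨h1, h2, h3, h4⟩ := h
  have hB : q'.2 = (step Q R C q).2 := by
    rcases h1 with ⟨h, e⟩ | ⟨h, e⟩ <;> simp [step, h, e]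
  set a := q'.1.getD q.1.length 0
  have ha : sInf {a | Alive Q R C (q.1 ++ [a], (step Q R C q).2)} = a := by
    rw [← hB]
    refine le_antisymm (Nat.sInf_le ?_) ?_
    · rw [Set.mem_ofPred_eq, ← h2]
      exact h3
    · by_contra! hlt
      exact h4 _ hlt (Nat.sInf_mem (s := {a | Alive Q R C (q.1 ++ [a], q'.2)})
        ⟨a, by rw [Set.mem_ofPred_eq, ← h2]; exact h3⟩)
  refine Prod.ext ?_ hB
  rw [h2, ← ha]
  rfl

theorem length_stage (k : ℕ) : (stage Q R C k).1.length = k := by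
  induction k with
  | zero => rfl
  | succ k ih => simp [stage, step, ih]

theorem stage_fst (k : ℕ) : (stage Q R C k).1 = (path Q R C).prefixList k := by
  induction k with
  | zero => rfl
  | succ k ih =>
    have h : (stage Q R C (k + 1)).1 = (stage Q R C k).1 ++
        [sInf {a | Alive Q R C ((stage Q R C k).1 ++ [a], (stage Q R C (k + 1)).2)}] := rfl
    have h' : path Q R C k =
        sInf {a | Alive Q R C ((stage Q R C k).1 ++ [a], (stage Q R C (k + 1)).2)} := by
      rw [path, h]
      conv_lhs => rw [← length_stage (Q := Q) (R := R) (C := C) k]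
      simp [length_stage]
    rw [Baire.prefixList_succ, h', ← ih, h]

theorem stage_snd_subset {k l : ℕ} (h : k ≤ l) : (stage Q R C k).2 ⊆ (stage Q R C l).2 := by
  classical
  induction h with
  | refl => exact List.Subset.refl _
  | step _ ih =>
    refine List.Subset.trans ih ?_
    simp only [stage, step]
    split_ifs
    · exact List.subset_cons_self _ _
    · exact List.Subset.refl _

theorem alive_stage (hQ : ∀ σ, {a | Q (σ, a) C}.Finite)
    (hT : ∀ N, ∃ τ, N ≤ τ.length ∧ InTree (Q · C) τ) (k : ℕ) :
    Alive Q R C (stage Q R C k) := by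
  induction k with
  | zero =>
    intro N
    obtain ⟨τ, h1, h2⟩ := hT N
    exact ⟨τ, h1, h2, by simp [stage]⟩
  | succ k ih => exact (stepRel_step hQ ih).2.2.1

theorem inTree_path (hQ : ∀ σ, {a | Q (σ, a) C}.Finite)
    (hT : ∀ N, ∃ τ, N ≤ τ.length ∧ InTree (Q · C) τ) (k : ℕ) :
    InTree (Q · C) ((path Q R C).prefixList k) := by
  obtain ⟨ρ, -, h, -⟩ := alive_stage (R := R) hQ hT k 0
  rw [← stage_fst]
  exact h.of_append

/-- The path meets the open condition with number `e` if and only if this was decided at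
stage `e`. -/
theorem exists_forces_iff (hQ : ∀ σ, {a | Q (σ, a) C}.Finite)
    (hT : ∀ N, ∃ τ, N ≤ τ.length ∧ InTree (Q · C) τ) (e : ℕ) :
    (∃ m, R (e, (Baire.join (path Q R C) C).prefixList m)) ↔
      ¬ Alive Q R C ((stage Q R C e).1, e :: (stage Q R C e).2) := by
  classical
  have avoid : ∀ k e, e ∈ (stage Q R C k).2 → Avoids R C ((path Q R C).prefixList k) e := by
    intro k e he
    obtain ⟨ρ, -, -, h⟩ := alive_stage (R := R) hQ hT k 0
    rw [← stage_fst]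
    exact (h e he).of_append
  constructor
  · rintro ⟨m, hm⟩ h
    have he : e ∈ (stage Q R C (e + 1)).2 := by
      simp [stage, step, length_stage, h]
    have h' := avoid _ e (stage_snd_subset (le_max_right m (e + 1)) he)
    refine h' m (by simp) ?_
    rwa [joinPrefix_prefixList (le_max_left _ _)]
  · intro h
    by_contra! H
    refine h fun N => ?_
    refine ⟨((path Q R C).prefixList (e + N)).drop e, by simp, ?_⟩
    have hd : (stage Q R C e).1 ++ ((path Q R C).prefixList (e + N)).drop e =
        (path Q R C).prefixList (e + N) := by
      rw [stage_fst, ← Baire.take_prefixList _ (Nat.le_add_right e N), List.take_append_drop]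
    simp only [hd]
    refine ⟨inTree_path hQ hT _, fun e' he' => ?_⟩
    rcases List.mem_cons.1 he' with rfl | he'
    · intro m hm
      rw [joinPrefix_prefixList (by simp at hm; omega)]
      exact H m
    · exact avoid _ _ (stage_snd_subset (Nat.le_add_right e N) he')

end

section

variable {D : Set Baire} {Q : List ℕ × ℕ → Baire → Prop} {R : ℕ × List ℕ → Prop}

theorem effSigma_inTree (hQ : EffSigma D 0 Q) :
    EffSigma D 0 fun (τ : List ℕ) C => InTree (Q · C) τ :=
  EffSigma.forall_lt (N := fun τ : List ℕ => τ.length)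
    (S := fun τ i C => Q (τ.take i, τ.getD i 0) C) (by fun_prop)
    (hQ.comp (f := fun p : List ℕ × ℕ => (p.1.take p.2, p.1.getD p.2 0)) (by fun_prop))

theorem effSigma_avoids (hR : PrimrecPred R) :
    EffSigma D 0 fun (p : List ℕ × ℕ) C => Avoids R C p.1 p.2 := by
  refine ⟨fun p => p.2.length = p.1.1.length ∧ ∀ m < p.1.1.length + 1,
    ¬ R (p.1.2, (List.range m).map fun k => Nat.pair (p.1.1.getD k 0) (p.2.getD k 0)), ?_, ?_⟩
  · exact (PrimrecPred.fun_eq (by fun_prop) (by fun_prop)).and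
      (PrimrecPred.fun_forall_lt (by fun_prop) (hR.not.comp (by fun_prop)))
  · intro p C _
    have key : ∀ m < p.1.length + 1, joinPrefix p.1 C m = (List.range m).map fun k =>
        Nat.pair (p.1.getD k 0) ((C.prefixList p.1.length).getD k 0) := by
      intro m hm
      refine List.map_congr_left fun k hk => ?_
      rw [List.mem_range] at hk
      rw [Baire.getD_prefixList _ (by omega)]
    simp only [Baire.length_prefixList, exists_eq_left, Avoids]
    exact forall₂_congr fun m hm => by rw [key m hm]

theorem effSigma_not_alive (hQ : EffSigma D 0 Q) (hR : PrimrecPred R) :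
    EffSigma D 1 fun q C => ¬ Alive Q R C q := by
  have h : EffSigma D 0 fun (p : ((List ℕ × List ℕ) × ℕ) × List ℕ) C => p.1.2 ≤ p.2.length ∧
      InTree (Q · C) (p.1.1.1 ++ p.2) ∧ ∀ e ∈ p.1.1.2, Avoids R C (p.1.1.1 ++ p.2) e := by
    refine (EffSigma.of_primrecPred (PrimrecPred.fun_le (by fun_prop) (by fun_prop))).and
      (((effSigma_inTree hQ).comp (f := fun p : ((List ℕ × List ℕ) × ℕ) × List ℕ =>
        p.1.1.1 ++ p.2) (by fun_prop)).and ?_)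
    exact EffSigma.forall_mem (L := fun p : ((List ℕ × List ℕ) × ℕ) × List ℕ => p.1.1.2)
      (S := fun p e C => Avoids R C (p.1.1.1 ++ p.2) e) (by fun_prop)
      ((effSigma_avoids hR).comp (f := fun q : (((List ℕ × List ℕ) × ℕ) × List ℕ) × ℕ =>
        (q.1.1.1.1 ++ q.1.2, q.2)) (by fun_prop))
  refine ⟨_, EffSigma.exist (S := fun (p : (List ℕ × List ℕ) × ℕ) ρ C => p.2 ≤ ρ.length ∧
    InTree (Q · C) (p.1.1 ++ ρ) ∧ ∀ e ∈ p.1.2, Avoids R C (p.1.1 ++ ρ) e) h, fun q C _ => ?_⟩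
  simp only [Alive, not_forall]

theorem effSigma_alive (hQ : EffSigma D 0 Q) (hR : PrimrecPred R) :
    EffSigma D 2 fun q C => Alive Q R C q :=
  (effSigma_not_alive hQ hR).not.congr fun _ _ _ => not_not.symm

theorem effSigma_stepRel (hQ : EffSigma D 0 Q) (hR : PrimrecPred R) :
    EffSigma D 2 fun (p : (List ℕ × List ℕ) × List ℕ × List ℕ) C => StepRel Q R C p.1 p.2 := by
  have ha := effSigma_alive hQ hR
  have hn := (effSigma_not_alive hQ hR).succ
  have f1 : Primrec fun p : (List ℕ × List ℕ) × List ℕ × List ℕ =>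
    (p.1.1, p.1.1.length :: p.1.2) := by fun_prop
  have f2 : Primrec fun p : (List ℕ × List ℕ) × List ℕ × List ℕ =>
    p.1.1.length :: p.1.2 := by fun_prop
  refine EffSigma.and (EffSigma.or ((ha.comp f1).and ?_) ((hn.comp f1).and ?_))
    (EffSigma.and ?_ (EffSigma.and (ha.comp (by fun_prop)) ?_))
  · exact EffSigma.of_primrecPred (PrimrecPred.fun_eq (by fun_prop) (by fun_prop))
  · exact EffSigma.of_primrecPred (PrimrecPred.fun_eq (by fun_prop) (by fun_prop))
  · exact EffSigma.of_primrecPred (PrimrecPred.fun_eq (by fun_prop) (by fun_prop))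
  · exact EffSigma.forall_lt (N := fun p : (List ℕ × List ℕ) × List ℕ × List ℕ =>
      p.2.1.getD p.1.1.length 0) (S := fun p a C => ¬ Alive Q R C (p.1.1 ++ [a], p.2.2))
      (by fun_prop) (hn.comp (f := fun q : ((List ℕ × List ℕ) × List ℕ × List ℕ) × ℕ =>
        (q.1.1.1 ++ [q.2], q.1.2.2)) (by fun_prop))

theorem effSigma_stage (hQ : EffSigma D 0 Q) (hR : PrimrecPred R)
    (hfin : ∀ C ∈ D, ∀ σ, {a | Q (σ, a) C}.Finite)
    (hT : ∀ C ∈ D, ∀ N, ∃ τ, N ≤ τ.length ∧ InTree (Q · C) τ) :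
    EffSigma D 2 fun (p : ℕ × List ℕ × List ℕ) C => stage Q R C p.1 = p.2 := by
  have h : EffSigma D 2 fun (p : (ℕ × List ℕ × List ℕ) × List (List ℕ × List ℕ)) C =>
      p.2.getD 0 default = ([], []) ∧ p.2.getD p.1.1 default = p.1.2 ∧
      ∀ i < p.1.1, StepRel Q R C (p.2.getD i default) (p.2.getD (i + 1) default) := by
    refine EffSigma.and ?_ (EffSigma.and ?_ ?_)
    · exact EffSigma.of_primrecPred (PrimrecPred.fun_eq (by fun_prop) (by fun_prop))
    · exact EffSigma.of_primrecPred (PrimrecPred.fun_eq (by fun_prop) (by fun_prop))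
    · exact EffSigma.forall_lt (N := fun p : (ℕ × List ℕ × List ℕ) × List (List ℕ × List ℕ) =>
        p.1.1) (S := fun p i C =>
          StepRel Q R C (p.2.getD i default) (p.2.getD (i + 1) default)) (by fun_prop)
        ((effSigma_stepRel hQ hR).comp
          (f := fun q : ((ℕ × List ℕ × List ℕ) × List (List ℕ × List ℕ)) × ℕ =>
            (q.1.2.getD q.2 default, q.1.2.getD (q.2 + 1) default)) (by fun_prop))
  refine (EffSigma.exist (S := fun (p : ℕ × List ℕ × List ℕ) (w : List (List ℕ × List ℕ)) C =>
    w.getD 0 default = ([], []) ∧ w.getD p.1 default = p.2 ∧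
      ∀ i < p.1, StepRel Q R C (w.getD i default) (w.getD (i + 1) default)) h).congr ?_
  rintro ⟨k, q⟩ C hC
  dsimp only
  constructor
  · rintro rfl
    have hw : ∀ i < k + 1, ((List.range (k + 1)).map (stage Q R C)).getD i default =
        stage Q R C i := by
      intro i hi
      simp [List.getD_eq_getElem?_getD, List.getElem?_range hi]
    refine ⟨(List.range (k + 1)).map (stage Q R C), ?_, ?_, fun i hi => ?_⟩
    · rw [hw 0 (by omega)]; rfl
    · exact hw k (by simp)
    · rw [hw i (by omega), hw (i + 1) (by omega)]
      exact stepRel_step (hfin C hC) (alive_stage (hfin C hC) (hT C hC) i)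
  · rintro ⟨w, h0, hk, hs⟩
    have hw : ∀ i ≤ k, w.getD i default = stage Q R C i := by
      intro i
      induction i with
      | zero => intro _; exact h0
      | succ i ih =>
        intro hi
        rw [(hs i (by omega)).eq_step, ih (by omega)]
        rfl
    exact (hw k le_rfl).symm.trans hk

/-- A low basis theorem: for a finitely branching tree that is effectively open in `C ∈ D` and has
arbitrarily long words there is a path `P C` such that the open conditions `R` on the pair of
`P C` and `C` are `𝚫⁰₃` conditions on `C`. -/
theorem exists_low_path (hQ : EffSigma D 0 Q) (hR : PrimrecPred R)
    (hfin : ∀ C ∈ D, ∀ σ, {a | Q (σ, a) C}.Finite)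
    (hT : ∀ C ∈ D, ∀ N, ∃ τ, N ≤ τ.length ∧ InTree (Q · C) τ) :
    ∃ P : Baire → Baire, (∀ C ∈ D, ∀ k, Q ((P C).prefixList k, P C k) C) ∧
      EffSigma D 2 (fun (p : ℕ × ℕ) C => P C p.1 = p.2) ∧
      EffSigma D 2 (fun e C => ∃ m, R (e, (Baire.join (P C) C).prefixList m)) ∧
      EffSigma D 2 (fun e C => ¬ ∃ m, R (e, (Baire.join (P C) C).prefixList m)) := by
  have hs := effSigma_stage hQ hR hfin hT
  have f1 : Primrec fun p : ℕ × List ℕ × List ℕ => (p.2.1, p.1 :: p.2.2) := by fun_prop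
  refine ⟨path Q R, fun C hC k => ?_, ?_, ?_, ?_⟩
  · have h := inTree_path (R := R) (hfin C hC) (hT C hC) (k + 1)
    rw [Baire.prefixList_succ, inTree_concat] at h
    exact h.2
  · refine (EffSigma.exist (S := fun (p : ℕ × ℕ) (q : List ℕ × List ℕ) C =>
      stage Q R C (p.1 + 1) = q ∧ q.1.getD p.1 0 = p.2) (EffSigma.and
        (hs.comp (f := fun r : (ℕ × ℕ) × List ℕ × List ℕ => (r.1.1 + 1, r.2)) (by fun_prop))
        (EffSigma.of_primrecPred (PrimrecPred.fun_eq (by fun_prop) (by fun_prop))))).congr ?_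
    intro p C _
    simp [path]
  · refine (EffSigma.exist (S := fun (e : ℕ) (q : List ℕ × List ℕ) C =>
      stage Q R C e = q ∧ ¬ Alive Q R C (q.1, e :: q.2)) (EffSigma.and hs
        ((effSigma_not_alive hQ hR).succ.comp f1))).congr ?_
    intro e C hC
    rw [exists_forces_iff (hfin C hC) (hT C hC)]
    simp
  · refine (EffSigma.exist (S := fun (e : ℕ) (q : List ℕ × List ℕ) C =>
      stage Q R C e = q ∧ Alive Q R C (q.1, e :: q.2)) (EffSigma.and hs
        ((effSigma_alive hQ hR).comp f1))).congr ?_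
    intro e C hC
    rw [exists_forces_iff (hfin C hC) (hT C hC)]
    simp

end

end LowBasis

/-! ### The Erdős–Rado tree of a coloring -/

@[fun_prop]
theorem Primrec.fun_sublists' {α β : Type} [Primcodable α] [Primcodable β] {f : α → List β}
    (hf : Primrec f) : Primrec fun a => (f a).sublists' := by
  have h : Primrec fun l : List β =>
      l.foldr (fun b s => s ++ s.map (List.cons b)) [[]] :=
    Primrec.list_foldr (h := fun _ (p : β × List (List β)) => p.2 ++ p.2.map (List.cons p.1))
      Primrec.id
      (Primrec.const _) (by unfold Primrec₂; fun_prop)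
  refine (h.comp hf).of_eq fun a => ?_
  induction f a with
  | nil => simp
  | cons b l ih => rw [List.foldr_cons, ih, List.sublists'_cons]

@[fun_prop]
theorem Primrec.fun_sum {α : Type} [Primcodable α] {f : α → List ℕ} (hf : Primrec f) :
    Primrec fun a => (f a).sum :=
  (Primrec.list_foldr (h := fun _ p => p.1 + p.2) hf (Primrec.const 0)
    (by unfold Primrec₂; fun_prop)).of_eq fun a => by rw [List.sum_eq_foldr]

/-- The points of Baire space with finite range. They code colorings of finite lists. -/
def finRangePoints : Set Baire := {C | (Set.range C).Finite}

namespace ErdosRado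

/-- The numbers `y` and `z` cannot be distinguished by the colors of `F ++ [y]` and `F ++ [z]`,
where `F` is a sublist of `σ` of length `n`. -/
def Agree (n : ℕ) (C : Baire) (σ : List ℕ) (y z : ℕ) : Prop :=
  ∀ F ∈ σ.sublists', F.length = n →
    C (Encodable.encode (F ++ [y])) = C (Encodable.encode (F ++ [z]))

/-- The one-step extension relation of the Erdős–Rado tree. -/
def Ext (n : ℕ) (p : List ℕ × ℕ) (C : Baire) : Prop :=
  (∀ b ∈ p.1, b < p.2) ∧
  (∀ i < p.1.length, Agree n C (p.1.take i) (p.1.getD i 0) p.2) ∧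
  ∀ y < p.2, (∀ b ∈ p.1, b < y) → ¬ Agree n C p.1 y p.2

section Effective

variable {D : Set Baire} {m : ℕ}

theorem effSigma_color (R : ℕ → ℕ → Prop) (hR : PrimrecPred fun p : ℕ × ℕ => R p.1 p.2) :
    EffSigma D m fun (p : List ℕ × List ℕ) C =>
      R (C (Encodable.encode p.1)) (C (Encodable.encode p.2)) := by
  refine (EffSigma.exist (S := fun (p : List ℕ × List ℕ) (q : ℕ) C =>
    C (Encodable.encode p.1) = q ∧ R q (C (Encodable.encode p.2)))
    (EffSigma.and
      (EffSigma.eval (f := fun r : (List ℕ × List ℕ) × ℕ => Encodable.encode r.1.1)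
        (R := fun s : ((List ℕ × List ℕ) × ℕ) × ℕ => s.2 = s.1.2) (by fun_prop)
        (PrimrecPred.fun_eq (by fun_prop) (by fun_prop)))
      (EffSigma.eval (f := fun r : (List ℕ × List ℕ) × ℕ => Encodable.encode r.1.2)
        (R := fun s : ((List ℕ × List ℕ) × ℕ) × ℕ => R s.1.2 s.2) (by fun_prop)
        (hR.comp (f := fun s : ((List ℕ × List ℕ) × ℕ) × ℕ => (s.1.2, s.2))
          (by fun_prop))))).congr ?_
  intro p C _
  simp

theorem effSigma_agree (n : ℕ) :
    EffSigma D m fun (p : List ℕ × ℕ × ℕ) C => Agree n C p.1 p.2.1 p.2.2 := by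
  refine EffSigma.forall_mem (L := fun p : List ℕ × ℕ × ℕ => p.1.sublists')
    (S := fun p F C => F.length = n →
      C (Encodable.encode (F ++ [p.2.1])) = C (Encodable.encode (F ++ [p.2.2]))) (by fun_prop) ?_
  refine EffSigma.congr (S := fun (q : (List ℕ × ℕ × ℕ) × List ℕ) C => ¬ q.2.length = n ∨
    C (Encodable.encode (q.2 ++ [q.1.2.1])) = C (Encodable.encode (q.2 ++ [q.1.2.2]))) ?_
    fun _ _ _ => imp_iff_not_or
  refine EffSigma.or (EffSigma.of_primrecPred
    (PrimrecPred.fun_eq (by fun_prop) (by fun_prop)).not) ?_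
  exact (effSigma_color (· = ·) (PrimrecPred.fun_eq (by fun_prop) (by fun_prop))).comp
    (f := fun q : (List ℕ × ℕ × ℕ) × List ℕ => (q.2 ++ [q.1.2.1], q.2 ++ [q.1.2.2])) (by fun_prop)

theorem effSigma_not_agree (n : ℕ) :
    EffSigma D m fun (p : List ℕ × ℕ × ℕ) C => ¬ Agree n C p.1 p.2.1 p.2.2 := by
  refine (EffSigma.exists_mem (L := fun p : List ℕ × ℕ × ℕ => p.1.sublists')
    (S := fun p F C => F.length = n ∧
      C (Encodable.encode (F ++ [p.2.1])) ≠ C (Encodable.encode (F ++ [p.2.2])))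
      (by fun_prop) ?_).congr ?_
  · refine EffSigma.and (EffSigma.of_primrecPred
      (PrimrecPred.fun_eq (by fun_prop) (by fun_prop))) ?_
    exact (effSigma_color (· ≠ ·) (PrimrecPred.fun_eq (by fun_prop) (by fun_prop)).not).comp
      (f := fun q : (List ℕ × ℕ × ℕ) × List ℕ => (q.2 ++ [q.1.2.1], q.2 ++ [q.1.2.2]))
      (by fun_prop)
  · intro p C _
    simp only [Agree]
    push Not
    rfl

theorem effSigma_ext (n : ℕ) : EffSigma D m (Ext n) := by
  have hlt {α : Type} [Primcodable α] {L : α → List ℕ} {f : α → ℕ} (hL : Primrec L)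
      (hf : Primrec f) : PrimrecPred fun a => ∀ b ∈ L a, b < f a :=
    (PrimrecRel.forall_mem_list Primrec.nat_lt).comp hL hf
  refine EffSigma.and (EffSigma.of_primrecPred (hlt (by fun_prop) (by fun_prop)))
    (EffSigma.and ?_ ?_)
  · exact EffSigma.forall_lt (N := fun p : List ℕ × ℕ => p.1.length)
      (S := fun p i C => Agree n C (p.1.take i) (p.1.getD i 0) p.2) (by fun_prop)
      ((effSigma_agree n).comp (f := fun q : (List ℕ × ℕ) × ℕ =>
        (q.1.1.take q.2, q.1.1.getD q.2 0, q.1.2)) (by fun_prop))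
  · refine EffSigma.forall_lt (N := fun p : List ℕ × ℕ => p.2)
      (S := fun p y C => (∀ b ∈ p.1, b < y) → ¬ Agree n C p.1 y p.2) (by fun_prop) ?_
    refine EffSigma.congr (S := fun (q : (List ℕ × ℕ) × ℕ) C => ¬ (∀ b ∈ q.1.1, b < q.2) ∨
      ¬ Agree n C q.1.1 q.2 q.1.2) ?_ fun _ _ _ => imp_iff_not_or
    exact (EffSigma.of_primrecPred (hlt (by fun_prop) (by fun_prop)).not).or
      ((effSigma_not_agree n).comp (f := fun q : (List ℕ × ℕ) × ℕ => (q.1.1, q.2, q.1.2))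
        (by fun_prop))

end Effective

section Combinatorics

variable {n : ℕ} {C : Baire}

theorem Agree.symm {σ : List ℕ} {y z : ℕ} (h : Agree n C σ y z) : Agree n C σ z y :=
  fun F hF hn => (h F hF hn).symm

theorem Agree.trans {σ : List ℕ} {x y z : ℕ} (h : Agree n C σ x y) (h' : Agree n C σ y z) :
    Agree n C σ x z := fun F hF hn => (h F hF hn).trans (h' F hF hn)

theorem Agree.take {σ : List ℕ} {y z : ℕ} (h : Agree n C σ y z) (i : ℕ) :
    Agree n C (σ.take i) y z := fun F hF hn => h F
  (List.mem_sublists'.2 ((List.mem_sublists'.1 hF).trans (List.take_sublist i σ))) hn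

theorem finite_ext (hC : C ∈ finRangePoints) (σ : List ℕ) : {a | Ext n (σ, a) C}.Finite := by
  have : Finite (Set.range C) := hC
  have : Finite {F // F ∈ σ.sublists'} := (List.finite_toSet σ.sublists').to_subtype
  let g : {a | Ext n (σ, a) C} → {F // F ∈ σ.sublists'} → Set.range C :=
    fun a F => ⟨C (Encodable.encode (F.1 ++ [a.1])), Set.mem_range_self _⟩
  have key : ∀ a a', Ext n (σ, a) C → Ext n (σ, a') C → Agree n C σ a a' → ¬ a < a' :=
    fun a a' h h' hag hlt => h'.2.2 a hlt h.1 hag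
  have hg : Function.Injective g := by
    rintro ⟨a, ha⟩ ⟨a', ha'⟩ h
    have hag : Agree n C σ a a' := by
      intro F hF _
      exact congrArg Subtype.val (congrFun h ⟨F, hF⟩)
    apply Subtype.ext
    have h1 := key a a' ha ha' hag
    have h2 := key a' a ha' ha hag.symm
    simp only
    omega
  exact Finite.of_injective g hg

/-- Every number is the last entry of a word in the Erdős–Rado tree. -/
theorem exists_inTree_concat (n : ℕ) (C : Baire) (y : ℕ) :
    ∃ τ, LowBasis.InTree (Ext n · C) (τ ++ [y]) := by
  have key : ∀ d τ u, LowBasis.InTree (Ext n · C) τ → (∀ b ∈ τ, b < y) →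
      (∀ i < τ.length, Agree n C (τ.take i) (τ.getD i 0) y) →
      (∀ z, (∀ b ∈ τ, b < z) → u ≤ z) → y - u ≤ d →
      ∃ τ, LowBasis.InTree (Ext n · C) (τ ++ [y]) := by
    classical
    intro d
    induction d with
    | zero =>
      intro τ u hT hlt hag hu hd
      have huy := hu y hlt
      refine ⟨τ, LowBasis.inTree_concat.2 ⟨hT, hlt, hag, fun z hz hz' => ?_⟩⟩
      have := hu z hz'
      simp only at hz
      omega
    | succ d ih =>
      intro τ u hT hlt hag hu hd
      have hex : ∃ z, (∀ b ∈ τ, b < z) ∧ Agree n C τ z y := ⟨y, hlt, fun _ _ _ => rfl⟩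
      set z := Nat.find hex with hz
      obtain ⟨hz1, hz2⟩ := Nat.find_spec hex
      rw [← hz] at hz1 hz2
      have hzy : z ≤ y := Nat.find_min' hex ⟨hlt, fun _ _ _ => rfl⟩
      have hTz : LowBasis.InTree (Ext n · C) (τ ++ [z]) := by
        refine LowBasis.inTree_concat.2 ⟨hT, hz1, fun i hi => (hag i hi).trans (hz2.symm.take i),
          fun w hw hw' hwz => ?_⟩
        exact Nat.find_min hex hw ⟨hw', hwz.trans hz2⟩
      rcases hzy.eq_or_lt with h | h
      · exact ⟨τ, h ▸ hTz⟩
      · refine ih (τ ++ [z]) (z + 1) hTz ?_ ?_ ?_ ?_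
        · intro b hb
          rcases List.mem_append.1 hb with hb | hb
          · exact hlt b hb
          · rw [List.mem_singleton.1 hb]; exact h
        · intro i hi
          rcases Nat.lt_succ_iff_lt_or_eq.1 (by simpa using hi) with hi | rfl
          · rw [List.take_append_of_le_length hi.le, List.getD_append _ _ _ _ hi]
            exact hag i hi
          · simpa using hz2
        · intro w hw
          exact hw z (by simp)
        · have := hu z hz1
          omega
  exact key y [] 0 (by intro i hi; simp at hi) (by simp) (by simp) (by simp) (by omega)

theorem exists_long_inTree (n : ℕ) (hC : C ∈ finRangePoints) (N : ℕ) :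
    ∃ τ, N ≤ τ.length ∧ LowBasis.InTree (Ext n · C) τ := by
  by_contra! H
  have hlev : ∀ L, {τ : List ℕ | τ.length = L ∧ LowBasis.InTree (Ext n · C) τ}.Finite := by
    intro L
    induction L with
    | zero => exact (Set.finite_singleton []).subset fun τ h => List.length_eq_zero_iff.1 h.1
    | succ L ih =>
      refine (ih.biUnion fun σ _ => (finite_ext (n := n) hC σ).image fun a => σ ++ [a]).subset ?_
      rintro τ ⟨hl, hT⟩
      obtain ⟨σ, a, rfl⟩ : ∃ σ a, τ = σ ++ [a] := by
        rcases List.eq_nil_or_concat τ with rfl | ⟨σ, a, h⟩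
        · simp at hl
        · exact ⟨σ, a, by simpa using h⟩
      rw [LowBasis.inTree_concat] at hT
      simp only [Set.mem_iUnion]
      exact ⟨σ, ⟨by simpa using hl, hT.1⟩, a, hT.2, rfl⟩
  have hfin : {τ : List ℕ | LowBasis.InTree (Ext n · C) τ}.Finite := by
    refine ((Set.finite_lt_nat N).biUnion fun L _ => hlev L).subset fun τ hτ => ?_
    simp only [Set.mem_iUnion]
    exact ⟨τ.length, not_le.1 fun h => H τ h hτ, rfl, hτ⟩
  choose τ hτ using exists_inTree_concat n C
  have hinj : Function.Injective fun y => τ y ++ [y] := by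
    intro y z h
    simpa using congrArg List.getLast? h
  exact Set.infinite_of_injective_forall_mem hinj hτ hfin

theorem sublist_range {l : List ℕ} (hl : l.Pairwise (· < ·)) {i : ℕ} (h : ∀ x ∈ l, x < i) :
    l.Sublist (List.range i) := by
  refine List.sublist_of_subperm_of_sortedLE ?_ hl.sortedLT.sortedLE
    (List.sortedLT_range i).sortedLE
  exact List.subperm_of_subset hl.sortedLT.nodup fun x hx => List.mem_range.2 (h x hx)

/-- A path `P` through the Erdős–Rado tree is prehomogeneous. -/
theorem color_eq_of_path {P : Baire} (hP : ∀ k, Ext n (P.prefixList k, P k) C) {l : List ℕ}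
    (hn : l.length = n) (hl : l.Pairwise (· < ·)) {i j : ℕ} (hi : ∀ x ∈ l, x < i)
    (hj : ∀ x ∈ l, x < j) :
    C (Encodable.encode (l.map P ++ [P i])) = C (Encodable.encode (l.map P ++ [P j])) := by
  have key : ∀ i j, i ≤ j → (∀ x ∈ l, x < i) →
      C (Encodable.encode (l.map P ++ [P i])) = C (Encodable.encode (l.map P ++ [P j])) := by
    intro i j hij hi
    rcases hij.eq_or_lt with rfl | hij
    · rfl
    have h := (hP j).2.1 i (by simpa using hij)
    simp only at h
    rw [Baire.take_prefixList _ hij.le, Baire.getD_prefixList _ hij] at h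
    exact h _ (List.mem_sublists'.2 ((sublist_range hl hi).map P)) (by simpa using hn)
  rcases le_total i j with h | h
  · exact key i j h hi
  · exact (key j i h hj).symm

theorem strictMono_of_path {P : Baire} (hP : ∀ k, Ext n (P.prefixList k, P k) C) :
    StrictMono P := by
  refine strictMono_nat_of_lt_succ fun k => ?_
  exact (hP (k + 1)).1 _ (by simp [Baire.prefixList_succ])

end Combinatorics

end ErdosRado

/-! ### Effective homogeneous sets -/

/-- The set `M` is homogeneous for the coloring of the increasing lists of length `n` coded
by `C`. -/
def HomogeneousFor (n : ℕ) (C : Baire) (M : Set ℕ) : Prop :=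
  ∃ a, ∀ l : List ℕ, l.length = n → l.Pairwise (· < ·) → (∀ x ∈ l, x ∈ M) →
    C (Encodable.encode l) = a

/-- The coloring of lists `l` induced by a pair `x` of a prehomogeneous sequence `P` and a
coloring `C`: the color of `P(l)` followed by a larger element of the sequence. -/
def inducedColoring (x : Baire) : Baire := fun z =>
  (x (Encodable.encode ((decodeD (List ℕ) z ++ [(decodeD (List ℕ) z).sum + 1]).map
    fun k => (x k).unpair.1))).unpair.2

theorem effSigma_inducedColoring {D : Set Baire} :
    EffSigma D 0 fun (p : ℕ × ℕ) x => inducedColoring x p.1 = p.2 := by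
  let L : ℕ → List ℕ := fun z => decodeD (List ℕ) z ++ [(decodeD (List ℕ) z).sum + 1]
  have hL : Primrec L := by fun_prop
  refine (EffSigma.exist (S := fun (p : ℕ × ℕ) (w : List ℕ) x =>
    w.length = (L p.1).length ∧ (∀ k < w.length, (x ((L p.1).getD k 0)).unpair.1 = w.getD k 0) ∧
      (x (Encodable.encode w)).unpair.2 = p.2) ?_).congr ?_
  · refine EffSigma.and (EffSigma.of_primrecPred (PrimrecPred.fun_eq (by fun_prop) (by fun_prop)))
      (EffSigma.and ?_ ?_)
    · exact EffSigma.forall_lt (N := fun q : (ℕ × ℕ) × List ℕ => q.2.length)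
        (S := fun q k x => (x ((L q.1.1).getD k 0)).unpair.1 = q.2.getD k 0) (by fun_prop)
        (EffSigma.eval (f := fun r : ((ℕ × ℕ) × List ℕ) × ℕ => (L r.1.1.1).getD r.2 0)
          (R := fun s : (((ℕ × ℕ) × List ℕ) × ℕ) × ℕ => s.2.unpair.1 = s.1.1.2.getD s.1.2 0)
          (by fun_prop) (PrimrecPred.fun_eq (by fun_prop) (by fun_prop)))
    · exact EffSigma.eval (f := fun q : (ℕ × ℕ) × List ℕ => Encodable.encode q.2)
        (R := fun s : ((ℕ × ℕ) × List ℕ) × ℕ => s.2.unpair.2 = s.1.1.2)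
        (by fun_prop) (PrimrecPred.fun_eq (by fun_prop) (by fun_prop))
  · rintro ⟨z, v⟩ x _
    dsimp only
    constructor
    · rintro rfl
      refine ⟨(L z).map fun k => (x k).unpair.1, by simp, fun k hk => ?_, rfl⟩
      rw [List.length_map] at hk
      rw [List.getD_eq_getElem _ _ hk, List.getD_eq_getElem _ _ (by simpa using hk),
        List.getElem_map]
    · rintro ⟨w, hw, hk, h⟩
      have : w = (L z).map fun k => (x k).unpair.1 := by
        refine List.ext_getElem (by simpa using hw) fun k h1 h2 => ?_
        have := hk k h1
        rw [List.getD_eq_getElem _ _ h1, List.getD_eq_getElem _ _ (hw ▸ h1)] at this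
        rw [List.getElem_map, this]
      rw [← h, this]
      rfl

theorem inducedColoring_join (P C : Baire) (l : List ℕ) :
    inducedColoring (Baire.join P C) (Encodable.encode l) =
      C (Encodable.encode (l.map P ++ [P (l.sum + 1)])) := by
  simp [inducedColoring, Baire.join]

theorem inducedColoring_join_mem (P : Baire) {C : Baire} (hC : C ∈ finRangePoints) :
    inducedColoring (Baire.join P C) ∈ finRangePoints := by
  refine Set.Finite.subset hC ?_
  rintro _ ⟨z, rfl⟩
  exact ⟨_, by rw [inducedColoring, Baire.join, Nat.unpair_pair]⟩

/-- The image of a homogeneous set of the induced coloring under a prehomogeneous sequence is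
homogeneous. -/
theorem homogeneousFor_image {n : ℕ} {P C : Baire}
    (hP : ∀ k, ErdosRado.Ext n (P.prefixList k, P k) C) {M : Set ℕ}
    (hM : HomogeneousFor n (inducedColoring (Baire.join P C)) M) :
    HomogeneousFor (n + 1) C (P '' M) := by
  obtain ⟨a, ha⟩ := hM
  have hmono := ErdosRado.strictMono_of_path hP
  refine ⟨a, fun l hl hs hmem => ?_⟩
  have hl' : (l.map (Function.invFun P)).map P = l := by
    rw [List.map_map]
    conv_rhs => rw [← List.map_id l]
    refine List.map_congr_left fun x hx => ?_
    obtain ⟨j, -, rfl⟩ := hmem x hx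
    simp [Function.leftInverse_invFun hmono.injective j]
  have hmem' : ∀ j ∈ l.map (Function.invFun P), j ∈ M := by
    intro j hj
    obtain ⟨x, hx, rfl⟩ := List.mem_map.1 hj
    obtain ⟨j, hj, rfl⟩ := hmem x hx
    rwa [Function.leftInverse_invFun hmono.injective j]
  generalize l.map (Function.invFun P) = l₀ at hl' hmem'
  subst hl'
  rw [List.length_map] at hl
  obtain ⟨F, j, rfl⟩ : ∃ F j, l₀ = F ++ [j] := by
    rcases List.eq_nil_or_concat l₀ with rfl | ⟨F, j, h⟩
    · simp at hl
    · exact ⟨F, j, by simpa using h⟩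
  rw [List.pairwise_map] at hs
  simp only [hmono.lt_iff_lt] at hs
  rw [List.pairwise_append] at hs
  have hF : F.length = n := by simpa using hl
  rw [List.map_append, List.map_singleton, ErdosRado.color_eq_of_path hP hF hs.1
    (fun x hx => hs.2.2 x hx j (by simp)) (j := F.sum + 1)
    (fun x hx => Nat.lt_succ_of_le (List.le_sum_of_mem hx)), ← inducedColoring_join P C]
  exact ha F hF hs.1 fun x hx => hmem' x (by simp [hx])

/-- For colorings of lists of length `n` there is a choice of infinite homogeneous sets that is
effectively `𝚫⁰ₙ₊₂`. -/
theorem exists_effective_homogeneous (n : ℕ) : ∃ M : Baire → Set ℕ,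
    (∀ C ∈ finRangePoints, (M C).Infinite ∧ HomogeneousFor n C (M C)) ∧
    EffSigma finRangePoints (n + 1) fun (p : ℕ × Bool) C => (p.1 ∈ M C ↔ p.2 = true) := by
  induction n with
  | zero =>
    refine ⟨fun _ => Set.univ, fun C _ => ⟨Set.infinite_univ, C (Encodable.encode ([] : List ℕ)),
      fun l hl _ _ => by rw [List.length_eq_zero_iff.1 hl]⟩, ?_⟩
    refine (EffSigma.of_primrecPred (R := fun p : ℕ × Bool => p.2 = true)
      (PrimrecPred.fun_eq (by fun_prop) (by fun_prop))).congr fun p C _ => ?_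
    simp
  | succ n ih =>
    obtain ⟨M, hM, hS⟩ := ih
    obtain ⟨β, _, _, T, hT, hTS⟩ := hS.exists_open_kernel
    let D' : Set Baire := {x | inducedColoring x ∈ finRangePoints}
    have hT' : EffSigma D' 0 fun (e : ℕ) x => T (decodeD β e) (inducedColoring x) :=
      EffSigma.subst_open (D' := finRangePoints) (S := fun e => T (decodeD β e))
        effSigma_inducedColoring (fun _ h => h) (hT.comp (by fun_prop))
    obtain ⟨R, hR, hRT⟩ := hT'
    obtain ⟨P, hP, hPg, h1, h2⟩ := LowBasis.exists_low_path (D := finRangePoints)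
      (ErdosRado.effSigma_ext n) hR (fun C hC => ErdosRado.finite_ext hC)
      (fun C hC => ErdosRado.exists_long_inTree n hC)
    have hRT' : ∀ b, ∀ C ∈ finRangePoints, T b (inducedColoring (Baire.join (P C) C)) ↔
        ∃ m, R (Encodable.encode b, (Baire.join (P C) C).prefixList m) := by
      intro b C hC
      rw [← hRT _ _ (inducedColoring_join_mem (P C) hC)]
      simp only [decodeD_encode]
    have hfin := hTS finRangePoints (fun C => inducedColoring (Baire.join (P C) C))
      (fun C hC => inducedColoring_join_mem (P C) hC)
      ((h1.comp (f := fun b : β => Encodable.encode b) (by fun_prop)).congr hRT')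
      ((h2.comp (f := fun b : β => Encodable.encode b) (by fun_prop)).congr
        fun b C hC => not_congr (hRT' b C hC))
    have hPg' : EffSigma finRangePoints (n + 2) fun (p : ℕ × ℕ) C => P C p.1 = p.2 :=
      hPg.mono (by omega)
    have hPn : EffSigma finRangePoints (n + 2) fun (p : ℕ × ℕ) C => P C p.1 ≠ p.2 := by
      refine (EffSigma.exist (S := fun (p : ℕ × ℕ) (v : ℕ) C => P C p.1 = v ∧ v ≠ p.2)
        (EffSigma.and (hPg'.comp (f := fun q : (ℕ × ℕ) × ℕ => (q.1.1, q.2)) (by fun_prop))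
          (EffSigma.of_primrecPred
            (PrimrecPred.fun_eq (by fun_prop) (by fun_prop)).not))).congr ?_
      intro p C _
      simp
    refine ⟨fun C => P C '' M (inducedColoring (Baire.join (P C) C)), fun C hC => ⟨?_, ?_⟩, ?_⟩
    · exact (hM _ (inducedColoring_join_mem (P C) hC)).1.image
        (ErdosRado.strictMono_of_path (hP C hC)).injective.injOn
    · exact homogeneousFor_image (hP C hC) (hM _ (inducedColoring_join_mem (P C) hC)).2
    · have hpos : EffSigma finRangePoints (n + 2) fun (i : ℕ) C =>
          ∃ j, P C j = i ∧ (j ∈ M (inducedColoring (Baire.join (P C) C)) ↔ true = true) :=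
        EffSigma.exist (S := fun (i j : ℕ) C => P C j = i ∧
          (j ∈ M (inducedColoring (Baire.join (P C) C)) ↔ true = true))
          (EffSigma.and (hPg'.comp (f := fun q : ℕ × ℕ => (q.2, q.1)) (by fun_prop))
            (hfin.comp (f := fun q : ℕ × ℕ => (q.2, true)) (by fun_prop)))
      have hneg : EffSigma finRangePoints (n + 2) fun (i : ℕ) C => ∀ j < i + 1, P C j ≠ i ∨
          (j ∈ M (inducedColoring (Baire.join (P C) C)) ↔ false = true) :=
        EffSigma.forall_lt (N := fun i : ℕ => i + 1) (S := fun (i j : ℕ) C => P C j ≠ i ∨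
          (j ∈ M (inducedColoring (Baire.join (P C) C)) ↔ false = true)) (by fun_prop)
          (EffSigma.or (hPn.comp (f := fun q : ℕ × ℕ => (q.2, q.1)) (by fun_prop))
            (hfin.comp (f := fun q : ℕ × ℕ => (q.2, false)) (by fun_prop)))
      refine (((EffSigma.of_primrecPred (R := fun p : ℕ × Bool => p.2 = true)
        (PrimrecPred.fun_eq (by fun_prop) (by fun_prop))).and
          (hpos.comp (f := fun p : ℕ × Bool => p.1) (by fun_prop))).or
        ((EffSigma.of_primrecPred (R := fun p : ℕ × Bool => p.2 = false)
        (PrimrecPred.fun_eq (by fun_prop) (by fun_prop))).and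
          (hneg.comp (f := fun p : ℕ × Bool => p.1) (by fun_prop)))).congr ?_
      rintro ⟨i, b⟩ C hC
      have hle : ∀ j, j ≤ P C j := fun j => (ErdosRado.strictMono_of_path (hP C hC)).le_apply
      have himg : i ∉ P C '' M (inducedColoring (Baire.join (P C) C)) ↔
          ∀ j < i + 1, P C j ≠ i ∨ j ∉ M (inducedColoring (Baire.join (P C) C)) := by
        constructor
        · intro h j _
          by_contra! H
          exact h ⟨j, H.2, H.1⟩
        · rintro h ⟨j, hj, rfl⟩
          rcases h j (Nat.lt_succ_of_le (hle j)) with h | h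
          · exact h rfl
          · exact h hj
      cases b
      · simpa using himg
      · simp [and_comm]

/-! ### From effective families to names -/

theorem EffSigma.exists_names {D : Set Baire} {m : ℕ} {α : Type} [Primcodable α]
    {S : α → Baire → Prop} (h : EffSigma D m S) : ∃ N : α → Baire,
      (Primrec fun q : α × ℕ => N q.1 q.2) ∧ ∀ a, ∀ x ∈ D, S a x ↔ x ∈ sigmaSet (m + 1) (N a) := by
  classical
  induction m generalizing α with
  | zero =>
    obtain ⟨R, hR, h⟩ := h
    refine ⟨fun a k => if R (a, decodeD (List ℕ) k) then k + 1 else 0, ?_, fun a x hx => ?_⟩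
    · exact Primrec.ite (hR.comp (f := fun q : α × ℕ => (q.1, decodeD (List ℕ) q.2))
        (by fun_prop)) (by fun_prop) (by fun_prop)
    · rw [h a x hx]
      simp only [sigmaSet]
      constructor
      · rintro ⟨k, hk⟩
        exact ⟨Encodable.encode (x.prefixList k), k, by simp [hk]⟩
      · rintro ⟨i, k, hik⟩
        refine ⟨k, ?_⟩
        split_ifs at hik with hR'
        obtain rfl : i = Encodable.encode (x.prefixList k) := by omega
        simpa using hR'
  | succ m ih =>
    obtain ⟨T, hT, h⟩ := h
    obtain ⟨N, hN, hTN⟩ := ih hT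
    refine ⟨fun a z => N (a, z.unpair.1) z.unpair.2,
      hN.comp (g := fun q : α × ℕ => ((q.1, q.2.unpair.1), q.2.unpair.2)) (by fun_prop),
      fun a x hx => ?_⟩
    have hrow : ∀ i, Baire.row (fun z => N (a, z.unpair.1) z.unpair.2) i = N (a, i) := by
      intro i
      funext k
      simp [Baire.row]
    simp only [sigmaSet, Set.mem_iUnion, Set.mem_compl_iff, hrow]
    rw [h a x hx]
    exact exists_congr fun j => not_congr (hTN (a, j) x hx)

theorem encode_decodeD (k : ℕ) : Encodable.encode (decodeD (List ℕ) k) = k := by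
  simp [decodeD]

/-- An operator that computes its value at `z` from one value of the input, at a place that is at
most `z`, is computable. -/
theorem computableOperator_of_eval {G : ℕ × ℕ → ℕ} (hG : Primrec G) {h : ℕ → ℕ} (hh : Primrec h)
    (hle : ∀ z, h z ≤ z) : ComputableOperator fun p z => G (z, p (h z)) := by
  refine ⟨fun u => (List.range u.length).map fun z => G (z, u.getD (h z) 0), ?_, ?_, ?_⟩
  · refine Primrec.to_comp ?_
    fun_prop
  · rintro u _ ⟨v, rfl⟩
    refine ⟨((List.range v.length).map fun z => u.length + z).map fun z =>
      G (z, (u ++ v).getD (h z) 0), ?_⟩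
    dsimp only
    rw [List.length_append, List.range_add, List.map_append]
    congr 1
    refine List.map_congr_left fun z hz => ?_
    rw [List.mem_range] at hz
    rw [List.getD_append _ _ _ _ ((hle z).trans_lt hz)]
  · intro p
    refine ⟨fun m => ?_, fun l => ⟨l, by simp⟩⟩
    simp only [Baire.length_prefixList, List.length_map, List.length_range]
    refine List.map_congr_left fun z hz => ?_
    rw [List.mem_range] at hz
    rw [Baire.getD_prefixList _ ((hle z).trans_lt hz)]

/-- A function whose graph is effectively `𝚺⁰ₘ₊₂` is effectively `𝚺⁰ₘ₊₂`-measurable. -/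
theorem effectivelySigmaMeasurable_of_graph {D : Set Baire} {m : ℕ} {f : Baire → Baire}
    (hf : EffSigma D (m + 1) fun (p : ℕ × ℕ) x => f x p.1 = p.2) :
    EffectivelySigmaMeasurable (m + 2) (PFun.res f D) := by
  have hV : EffSigma D (m + 1) fun (e : ℕ) x => e ≠ 0 ∧
      ∀ k < (decodeD (List ℕ) (e - 1)).length, f x k = (decodeD (List ℕ) (e - 1)).getD k 0 :=
    (EffSigma.of_primrecPred (PrimrecPred.fun_eq (by fun_prop) (by fun_prop)).not).and
      (hf.forall_getD_eq.comp (f := fun e : ℕ => decodeD (List ℕ) (e - 1)) (by fun_prop))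
  obtain ⟨T, hT, hVT⟩ := hV
  obtain ⟨N, hN, hTN⟩ := hT.exists_names
  have hΦ := computableOperator_of_eval
    (G := fun q => N (q.2, q.1.unpair.1.unpair.2) q.1.unpair.2)
    (h := fun z => z.unpair.1.unpair.1)
    (hN.comp (g := fun q : ℕ × ℕ => ((q.2, q.1.unpair.1.unpair.2), q.1.unpair.2)) (by fun_prop))
    (by fun_prop) fun z => (Nat.unpair_left_le _).trans (Nat.unpair_left_le _)
  refine ⟨_, hΦ, fun p => ?_⟩
  ext x
  have hrow : ∀ i, Baire.row (fun z => N (p z.unpair.1.unpair.1, z.unpair.1.unpair.2) z.unpair.2) i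
      = N (p i.unpair.1, i.unpair.2) := by
    intro i
    funext k
    simp [Baire.row]
  have hpre : x ∈ (PFun.res f D).preimage (sigmaSet 1 p) ↔ f x ∈ sigmaSet 1 p ∧ x ∈ D := by
    rw [PFun.mem_preimage]
    constructor
    · rintro ⟨y, hy, hxy⟩
      obtain ⟨hx, rfl⟩ := (PFun.mem_res f D x y).1 hxy
      exact ⟨hy, hx⟩
    · rintro ⟨hy, hx⟩
      exact ⟨_, hy, (PFun.mem_res f D x _).2 ⟨hx, rfl⟩⟩
  have hdom : x ∈ (PFun.res f D).Dom ↔ x ∈ D := Iff.rfl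
  rw [hpre, Set.mem_inter_iff, hdom]
  refine and_congr_left fun hx => ?_
  simp only [sigmaSet, Set.mem_iUnion, Set.mem_compl_iff, hrow]
  have hV' : (∃ i : ℕ, x ∉ sigmaSet (m + 1) (N (p i.unpair.1, i.unpair.2))) ↔
      ∃ i, p i ≠ 0 ∧ ∀ k < (decodeD (List ℕ) (p i - 1)).length,
        f x k = (decodeD (List ℕ) (p i - 1)).getD k 0 := by
    constructor
    · rintro ⟨i, hi⟩
      rw [← hTN _ x hx] at hi
      exact ⟨_, (hVT _ x hx).2 ⟨_, hi⟩⟩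
    · rintro ⟨i, hi⟩
      obtain ⟨j, hj⟩ := (hVT _ x hx).1 hi
      refine ⟨Nat.pair i j, ?_⟩
      rw [← hTN _ x hx]
      simpa using hj
  rw [hV', Set.mem_ofPred_eq]
  refine exists_congr fun i => ?_
  rw [← Baire.prefixList_eq_iff]
  constructor
  · rintro ⟨k, hk⟩
    simp [hk]
  · rintro ⟨hi, h⟩
    refine ⟨(decodeD (List ℕ) (p i - 1)).length, ?_⟩
    rw [h, encode_decodeD]
    omega

/-! ### The standard numbering -/

/-- A number of the set of entries of an increasing list of length `n`, whose entries are at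
least `s`. -/
def listIndex : ℕ → ℕ → List ℕ → ℕ
  | 0, _, _ => 0
  | 1, s, l => l.headI - s
  | n + 2, s, l => Nat.pair (l.headI - s) (listIndex (n + 1) (l.headI + 1) l.tail)

theorem primrec_listIndex (n : ℕ) : Primrec fun p : ℕ × List ℕ => listIndex n p.1 p.2 := by
  induction n with
  | zero => exact Primrec.const 0
  | succ n ih =>
    cases n with
    | zero =>
      simp only [listIndex]
      fun_prop
    | succ n =>
      simp only [listIndex]
      exact Primrec.fun_natPair (by fun_prop)
        (ih.comp (g := fun p : ℕ × List ℕ => (p.2.headI + 1, p.2.tail)) (by fun_prop))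

theorem sum_tupleEntry_listIndex (n : ℕ) : ∀ (s : ℕ) (l : List ℕ), l.length = n →
    l.Pairwise (· < ·) → (∀ x ∈ l, s ≤ x) → ∀ k < n,
    s + k + ∑ j ∈ Finset.range (k + 1), tupleEntry n (listIndex n s l) j = l.getD k 0 := by
  induction n with
  | zero => intro s l _ _ _ k hk; omega
  | succ n ih =>
    intro s l hl hp hs k hk
    obtain ⟨x, t, rfl⟩ := List.exists_of_length_succ l hl
    have hx := hs x (by simp)
    cases n with
    | zero =>
      obtain rfl : k = 0 := by omega
      simp [tupleEntry, listIndex]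
      omega
    | succ n =>
      rw [List.pairwise_cons] at hp
      cases k with
      | zero =>
        simp [tupleEntry, listIndex]
        omega
      | succ k =>
        have h := ih (x + 1) t (by simpa using hl) hp.2 (fun y hy => hp.1 y hy) k (by omega)
        rw [Finset.sum_range_succ']
        simp only [listIndex, tupleEntry, Nat.unpair_pair, List.headI_cons, List.tail_cons,
          List.getD_cons_succ]
        omega

theorem theta_listIndex {n : ℕ} {l : List ℕ} (hl : l.length = n) (hp : l.Pairwise (· < ·)) :
    (theta n (listIndex n 0 l)).1 = l.toFinset := by
  ext x
  simp only [theta, Finset.mem_image, Finset.mem_range, List.mem_toFinset]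
  have key := sum_tupleEntry_listIndex n 0 l hl hp (by simp)
  simp only [zero_add] at key
  constructor
  · rintro ⟨k, hk, rfl⟩
    rw [key k hk, List.getD_eq_getElem _ _ (hl ▸ hk)]
    exact List.getElem_mem _
  · intro hx
    obtain ⟨k, hk, rfl⟩ := List.getElem_of_mem hx
    exact ⟨k, hl ▸ hk, by rw [key k (hl ▸ hk), List.getD_eq_getElem _ _ hk]⟩

/-! ### Measurability of Ramsey's theorem -/

/-- The coloring of lists of length `n` obtained from a name of a coloring. -/
def listColoring (n : ℕ) (p : Baire) : Baire := fun z => p (listIndex n 0 (decodeD (List ℕ) z))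

theorem listColoring_mem (n : ℕ) {p : Baire} (hp : p ∈ finRangePoints) :
    listColoring n p ∈ finRangePoints := by
  refine Set.Finite.subset hp ?_
  rintro _ ⟨z, rfl⟩
  exact ⟨_, rfl⟩

theorem effSigma_listColoring {D : Set Baire} (n : ℕ) :
    EffSigma D 0 fun (q : ℕ × ℕ) p => listColoring n p q.1 = q.2 :=
  EffSigma.eval (f := fun q : ℕ × ℕ => listIndex n 0 (decodeD (List ℕ) q.1))
    (R := fun s : (ℕ × ℕ) × ℕ => s.2 = s.1.2)
    ((primrec_listIndex n).comp (g := fun q : ℕ × ℕ => (0, decodeD (List ℕ) q.1)) (by fun_prop))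
    (PrimrecPred.fun_eq (by fun_prop) (by fun_prop))

theorem mem_homogeneousSets {n : ℕ} {k : ℕ∞} {c : Coloring n k} {p : Baire}
    (hpc : RepresentedSpace.Names p c) {M : Set ℕ} (hM : M.Infinite)
    (h : HomogeneousFor n (listColoring n p) M) : M ∈ homogeneousSets c := by
  obtain ⟨a, ha⟩ := h
  refine ⟨hM, a, fun A hA => ?_⟩
  have hl : (A.1.sort (· ≤ ·)).length = n := by rw [Finset.length_sort, A.2]
  have hs : (A.1.sort (· ≤ ·)).Pairwise (· < ·) := (Finset.sortedLT_sort A.1).pairwise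
  rw [← ha _ hl hs fun x hx => hA (by simpa using hx), listColoring, decodeD_encode,
    hpc (listIndex n 0 _)]
  exact congrArg c.1 (Subtype.ext (by rw [theta_listIndex hl hs, Finset.sort_toFinset]))

theorem RT_effectivelySigmaMeasurable (n : ℕ) (k : ℕ∞) :
    (RT n k).EffectivelySigmaMeasurable (n + 2) := by
  classical
  obtain ⟨M, hM, hS⟩ := exists_effective_homogeneous n
  have hS' := EffSigma.subst (effSigma_listColoring n)
    (fun p (hp : p ∈ finRangePoints) => listColoring_mem n hp) hS
  refine ⟨_, ?_, effectivelySigmaMeasurable_of_graph (D := finRangePoints)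
    (f := fun p i => if i ∈ M (listColoring n p) then 1 else 0) ?_⟩
  · intro p c hpc _
    have hp : p ∈ finRangePoints := by
      refine c.2.2.subset ?_
      rintro _ ⟨i, rfl⟩
      exact ⟨theta n i, (hpc i).symm⟩
    obtain ⟨h1, h2⟩ := hM _ (listColoring_mem n hp)
    refine ⟨_, (PFun.mem_res _ _ _ _).2 ⟨hp, rfl⟩, M (listColoring n p), mem_homogeneousSets hpc h1 h2, fun i => ?_⟩
    constructor <;> intro h <;> simp [h]
  · refine (((EffSigma.of_primrecPred (R := fun q : ℕ × ℕ => q.2 = 1)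
      (PrimrecPred.fun_eq (by fun_prop) (by fun_prop))).and
        (hS'.comp (f := fun q : ℕ × ℕ => (q.1, true)) (by fun_prop))).or
      ((EffSigma.of_primrecPred (R := fun q : ℕ × ℕ => q.2 = 0)
      (PrimrecPred.fun_eq (by fun_prop) (by fun_prop))).and
        (hS'.comp (f := fun q : ℕ × ℕ => (q.1, false)) (by fun_prop)))).congr ?_
    rintro ⟨i, v⟩ p _
    dsimp only
    split_ifs with h <;> simp [h, eq_comm]

theorem SRT_effectivelySigmaMeasurable (n : ℕ) (k : ℕ∞) :
    (SRT n k).EffectivelySigmaMeasurable (n + 2) := by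
  obtain ⟨F, hF, hmeas⟩ := RT_effectivelySigmaMeasurable n k
  exact ⟨F, fun p c hpc _ => hF p c hpc trivial, hmeas⟩

/-! ### The finite Borel hierarchy of Baire space -/

/-- `BorelSigma m S` says that `S` is a `𝚺⁰ₘ₊₁` subset of Baire space. -/
def BorelSigma : ℕ → Set Baire → Prop
  | 0, S => IsOpen S
  | m + 1, S => ∃ V : ℕ → Set Baire, (∀ i, BorelSigma m (V i)) ∧ S = ⋃ i, (V i)ᶜ

namespace BorelSigma

variable {m : ℕ} {S T : Set Baire}

theorem preimage (h : BorelSigma m S) {g : Baire → Baire} (hg : Continuous g) :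
    BorelSigma m (g ⁻¹' S) := by
  induction m generalizing S with
  | zero => exact IsOpen.preimage hg h
  | succ m ih =>
    obtain ⟨V, hV, rfl⟩ := h
    exact ⟨fun i => g ⁻¹' V i, fun i => ih (hV i), by simp [Set.preimage_iUnion]⟩

theorem compl (h : BorelSigma m S) : BorelSigma (m + 1) Sᶜ :=
  ⟨fun _ => S, fun _ => h, by rw [Set.iUnion_const]⟩

theorem iUnion {S : ℕ → Set Baire} (h : ∀ i, BorelSigma m (S i)) : BorelSigma m (⋃ i, S i) := by
  cases m with
  | zero => exact isOpen_iUnion h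
  | succ m =>
    choose V hV hS using h
    refine ⟨fun k => V k.unpair.1 k.unpair.2, fun k => hV _ _, ?_⟩
    simp only [hS]
    ext x
    simp only [Set.mem_iUnion]
    exact ⟨fun ⟨i, j, h⟩ => ⟨Nat.pair i j, by simpa using h⟩, fun ⟨k, h⟩ => ⟨_, _, h⟩⟩

theorem iUnion_countable {ι : Type} [Encodable ι] [Nonempty ι] {S : ι → Set Baire}
    (h : ∀ i, BorelSigma m (S i)) : BorelSigma m (⋃ i, S i) := by
  obtain ⟨f, hf⟩ := exists_surjective_nat ι
  rw [← hf.iUnion_comp]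
  exact iUnion fun i => h (f i)

theorem union (hS : BorelSigma m S) (hT : BorelSigma m T) : BorelSigma m (S ∪ T) := by
  have : S ∪ T = ⋃ b : Bool, cond b S T := Set.union_eq_iUnion
  rw [this]
  exact iUnion_countable fun b => by cases b <;> assumption

theorem inter (hS : BorelSigma m S) (hT : BorelSigma m T) : BorelSigma m (S ∩ T) := by
  cases m with
  | zero => exact IsOpen.inter hS hT
  | succ m =>
    obtain ⟨V, hV, rfl⟩ := hS
    obtain ⟨W, hW, rfl⟩ := hT
    refine ⟨fun k => V k.unpair.1 ∪ W k.unpair.2, fun k => (hV _).union (hW _), ?_⟩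
    ext x
    simp only [Set.mem_inter_iff, Set.mem_iUnion, Set.mem_compl_iff, Set.mem_union, not_or]
    exact ⟨fun ⟨⟨i, hi⟩, j, hj⟩ => ⟨Nat.pair i j, by simp [hi, hj]⟩,
      fun ⟨k, h1, h2⟩ => ⟨⟨_, h1⟩, _, h2⟩⟩

theorem of_isClopen (h : IsClopen S) : BorelSigma m S := by
  induction m generalizing S with
  | zero => exact h.isOpen
  | succ m ih => exact compl_compl S ▸ (ih h.compl).compl

end BorelSigma

/-- The cylinder of a finite word. -/
def cylinder (w : List ℕ) : Set Baire := {x | x.prefixList w.length = w}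

theorem isClopen_cylinder (w : List ℕ) : IsClopen (cylinder w) := by
  have : cylinder w = ⋂ k ∈ Finset.range w.length, {x : Baire | x k = w.getD k 0} := by
    ext x
    simp only [cylinder, Set.mem_ofPred_eq, Baire.prefixList_eq_iff, Set.mem_iInter,
      Finset.mem_range]
  rw [this]
  exact isClopen_biInter_finset fun k _ =>
    (isClopen_discrete {w.getD k 0}).preimage (continuous_apply k)

theorem mem_cylinder_prefixList (x : Baire) (m : ℕ) : x ∈ cylinder (x.prefixList m) := by
  simp [cylinder]

theorem exists_cylinder_subset {S : Set Baire} (hS : IsOpen S) {x : Baire} (hx : x ∈ S) :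
    ∃ m, cylinder (x.prefixList m) ⊆ S := by
  obtain ⟨I, u, hu, hI⟩ := isOpen_pi_iff.1 hS x hx
  refine ⟨I.sup id + 1, fun y hy => hI fun k hk => ?_⟩
  have hk' : k < I.sup id + 1 := Nat.lt_succ_of_le (Finset.le_sup (f := id) hk)
  have := (Baire.prefixList_eq_iff _ _).1 hy k (by simpa using hk')
  rw [Baire.getD_prefixList _ hk'] at this
  rw [this]
  exact (hu k hk).2

theorem exists_iUnion_isClopen {S : Set Baire} (hS : IsOpen S) :
    ∃ U : ℕ → Set Baire, (∀ k, IsClopen (U k)) ∧ S = ⋃ k, U k := by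
  classical
  let U : ℕ → Set Baire := fun k =>
    if cylinder (decodeD (List ℕ) k) ⊆ S then cylinder (decodeD (List ℕ) k) else ∅
  refine ⟨U, fun k => ?_, ?_⟩
  · simp only [U]
    split_ifs
    · exact isClopen_cylinder _
    · exact isClopen_empty
  · ext x
    simp only [Set.mem_iUnion, U]
    constructor
    · intro hx
      obtain ⟨k, hk⟩ := exists_cylinder_subset hS hx
      refine ⟨Encodable.encode (x.prefixList k), ?_⟩
      rw [decodeD_encode, if_pos hk]
      exact mem_cylinder_prefixList x k
    · rintro ⟨k, hk⟩
      split_ifs at hk with hS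
      · exact hS hk
      · exact hk.elim

theorem BorelSigma.succ {m : ℕ} {S : Set Baire} (h : BorelSigma m S) : BorelSigma (m + 1) S := by
  induction m generalizing S with
  | zero =>
    obtain ⟨U, hU, rfl⟩ := exists_iUnion_isClopen h
    exact ⟨fun k => (U k)ᶜ, fun k => (hU k).compl.isOpen, by simp only [compl_compl]⟩
  | succ m ih =>
    obtain ⟨V, hV, rfl⟩ := h
    exact ⟨V, fun i => ih (hV i), rfl⟩

theorem continuous_row (i : ℕ) : Continuous fun x : Baire => x.row i :=
  continuous_pi fun _ => continuous_apply _

theorem borelSigma_sigmaSet (m : ℕ) {f g : Baire → Baire} (hf : Continuous f)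
    (hg : Continuous g) : BorelSigma m {x | f x ∈ sigmaSet (m + 1) (g x)} := by
  induction m generalizing g with
  | zero =>
    have : {x | f x ∈ sigmaSet 1 (g x)} = ⋃ i, ⋃ w : List ℕ,
        {x | g x i = Encodable.encode w + 1} ∩ f ⁻¹' cylinder w := by
      ext x
      simp only [sigmaSet, Set.mem_ofPred_eq, Set.mem_iUnion, Set.mem_inter_iff, Set.mem_preimage]
      constructor
      · rintro ⟨i, k, h⟩
        exact ⟨i, _, h, mem_cylinder_prefixList _ _⟩
      · rintro ⟨i, w, h, h'⟩
        exact ⟨i, w.length, by rw [h, h']⟩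
    rw [zero_add, this]
    refine isOpen_iUnion fun i => isOpen_iUnion fun w => IsOpen.inter ?_
      ((isClopen_cylinder w).isOpen.preimage hf)
    exact (isOpen_discrete {Encodable.encode w + 1}).preimage ((continuous_apply i).comp hg)
  | succ m ih =>
    refine ⟨fun i => {x | f x ∈ sigmaSet (m + 1) ((g x).row i)},
      fun i => ih ((continuous_row i).comp hg), ?_⟩
    ext x
    simp [sigmaSet]

theorem exists_rows (q : ℕ → Baire) : ∃ p : Baire, ∀ i, p.row i = q i :=
  ⟨fun z => q z.unpair.1 z.unpair.2, fun i => by funext k; simp [Baire.row]⟩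

theorem BorelSigma.exists_name {m : ℕ} {S : Set Baire} (h : BorelSigma m S) :
    ∃ p, S = sigmaSet (m + 1) p := by
  classical
  induction m generalizing S with
  | zero =>
    refine ⟨fun k => if cylinder (decodeD (List ℕ) k) ⊆ S then k + 1 else 0, ?_⟩
    ext x
    simp only [sigmaSet, Set.mem_ofPred_eq]
    constructor
    · intro hx
      obtain ⟨k, hk⟩ := exists_cylinder_subset h hx
      exact ⟨Encodable.encode (x.prefixList k), k, by simp [hk]⟩
    · rintro ⟨i, k, hik⟩
      split_ifs at hik with hS
      obtain rfl : i = Encodable.encode (x.prefixList k) := by omega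
      rw [decodeD_encode] at hS
      exact hS (mem_cylinder_prefixList x k)
  | succ m ih =>
    obtain ⟨V, hV, rfl⟩ := h
    choose q hq using fun i => ih (hV i)
    obtain ⟨p, hp⟩ := exists_rows q
    exact ⟨p, by simp only [sigmaSet, hp, ← hq]⟩

/-- `BorelDelta m S` says that `S` is a `𝚫⁰ₘ₊₁` subset of Baire space. -/
def BorelDelta (m : ℕ) (S : Set Baire) : Prop := BorelSigma m S ∧ BorelSigma m Sᶜ

namespace BorelDelta

variable {m : ℕ} {S T : Set Baire}

theorem compl (h : BorelDelta m S) : BorelDelta m Sᶜ := ⟨h.2, by rw [compl_compl]; exact h.1⟩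

theorem union (hS : BorelDelta m S) (hT : BorelDelta m T) : BorelDelta m (S ∪ T) :=
  ⟨hS.1.union hT.1, by rw [Set.compl_union]; exact hS.2.inter hT.2⟩

theorem inter (hS : BorelDelta m S) (hT : BorelDelta m T) : BorelDelta m (S ∩ T) := by
  have := (hS.compl.union hT.compl).compl
  rwa [← Set.compl_inter, compl_compl] at this

theorem of_isClopen (h : IsClopen S) : BorelDelta m S :=
  ⟨.of_isClopen h, .of_isClopen h.compl⟩

theorem biUnion_lt {S : ℕ → Set Baire} (h : ∀ i, BorelDelta m (S i)) (N : ℕ) :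
    BorelDelta m (⋃ i < N, S i) := by
  induction N with
  | zero => simpa using of_isClopen isClopen_empty
  | succ N ih =>
    rw [Set.biUnion_lt_succ]
    exact ih.union (h N)

theorem biInter_lt {S : ℕ → Set Baire} (h : ∀ i, BorelDelta m (S i)) (N : ℕ) :
    BorelDelta m (⋂ i < N, S i) := by
  have := (biUnion_lt (fun i => (h i).compl) N).compl
  simpa [Set.compl_iUnion] using this

end BorelDelta

/-- A `𝚺⁰ₘ₊₁` set is the union of an increasing sequence of `𝚫⁰ₘ₊₁` sets. -/
theorem BorelSigma.exists_monotone_delta {m : ℕ} {V : Set Baire} (h : BorelSigma m V) :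
    ∃ W : ℕ → Set Baire, (∀ k, BorelDelta m (W k)) ∧ Monotone W ∧ V = ⋃ k, W k := by
  classical
  suffices H : ∃ W : ℕ → Set Baire, (∀ k, BorelDelta m (W k)) ∧ V = ⋃ k, W k by
    obtain ⟨W, hW, rfl⟩ := H
    refine ⟨fun k => ⋃ i < k, W i, fun k => .biUnion_lt hW k, fun k l hkl => ?_, ?_⟩
    · exact Set.biUnion_subset_biUnion_left fun i hi => lt_of_lt_of_le hi hkl
    · ext x
      simp only [Set.mem_iUnion]
      exact ⟨fun ⟨i, hi⟩ => ⟨i + 1, i, by omega, hi⟩, fun ⟨_, i, _, hi⟩ => ⟨i, hi⟩⟩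
  cases m with
  | zero =>
    obtain ⟨U, hU, rfl⟩ := exists_iUnion_isClopen h
    exact ⟨U, fun k => .of_isClopen (hU k), rfl⟩
  | succ m =>
    obtain ⟨U, hU, rfl⟩ := h
    refine ⟨fun k => (U k)ᶜ, fun k => ⟨(hU k).compl, ?_⟩, rfl⟩
    rw [compl_compl]
    exact (hU k).succ

/-- Two `𝚺⁰ₘ₊₂` sets can be separated in the limit, outside their intersection, by a sequence
of `𝚫⁰ₘ₊₁` sets. -/
theorem exists_limit_separation {m : ℕ} {A₀ A₁ : Set Baire} (h₀ : BorelSigma (m + 1) A₀)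
    (h₁ : BorelSigma (m + 1) A₁) : ∃ E : ℕ → Set Baire, (∀ s, BorelDelta m (E s)) ∧
      (∀ x, x ∈ A₀ → x ∉ A₁ → ∀ᶠ s in Filter.atTop, x ∈ E s) ∧
      ∀ x, x ∈ A₁ → x ∉ A₀ → ∀ᶠ s in Filter.atTop, x ∉ E s := by
  obtain ⟨V₀, hV₀, rfl⟩ := h₀
  obtain ⟨V₁, hV₁, rfl⟩ := h₁
  choose W₀ hW₀ hm₀ he₀ using fun j => (hV₀ j).exists_monotone_delta
  choose W₁ hW₁ hm₁ he₁ using fun j => (hV₁ j).exists_monotone_delta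
  have hev : ∀ {V : ℕ → Set Baire} {W : ℕ → ℕ → Set Baire}, (∀ j, Monotone (W j)) →
      (∀ j, V j = ⋃ k, W j k) → ∀ x, x ∉ ⋃ i, (V i)ᶜ → ∀ N,
      ∀ᶠ s in Filter.atTop, ∀ j < N, x ∈ W j s := by
    intro V W hm he x hx N
    refine (Filter.eventually_all_finite (Set.finite_lt_nat N)).2 fun j _ => ?_
    have hj : x ∈ V j := by
      by_contra h
      exact hx (Set.mem_iUnion.2 ⟨j, h⟩)
    rw [he j, Set.mem_iUnion] at hj
    obtain ⟨k, hk⟩ := hj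
    exact Filter.eventually_atTop.2 ⟨k, fun s hs => hm j hs hk⟩
  have hstay : ∀ {V : ℕ → Set Baire} {W : ℕ → ℕ → Set Baire},
      (∀ j, V j = ⋃ k, W j k) → ∀ x, x ∈ ⋃ i, (V i)ᶜ → ∃ j, ∀ s, x ∉ W j s := by
    intro V W he x hx
    obtain ⟨j, hj⟩ := Set.mem_iUnion.1 hx
    refine ⟨j, fun s hs => hj ?_⟩
    rw [he j]
    exact Set.mem_iUnion.2 ⟨s, hs⟩
  refine ⟨fun s => ⋃ j < s + 1, (W₀ j s)ᶜ ∩ ⋂ i < j, W₁ i s, fun s => ?_, ?_, ?_⟩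
  · exact .biUnion_lt (fun j => (hW₀ j s).compl.inter (.biInter_lt (fun i => hW₁ i s) j)) _
  · intro x hx₀ hx₁
    obtain ⟨j, hj⟩ := hstay he₀ x hx₀
    filter_upwards [hev hm₁ he₁ x hx₁ j, Filter.eventually_ge_atTop j] with s hs hjs
    simp only [Set.mem_iUnion, Set.mem_inter_iff, Set.mem_iInter, Set.mem_compl_iff]
    exact ⟨j, by omega, hj s, hs⟩
  · intro x hx₁ hx₀
    obtain ⟨j, hj⟩ := hstay he₁ x hx₁
    filter_upwards [hev hm₀ he₀ x hx₀ (j + 1)] with s hs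
    simp only [Set.mem_iUnion, Set.mem_inter_iff, Set.mem_iInter, Set.mem_compl_iff]
    rintro ⟨i, -, hi, hi'⟩
    by_cases hij : i < j + 1
    · exact hi (hs i hij)
    · exact hj s (hi' j (by omega))

/-! ### Iterated limits -/

/-- The iterated limit of `c (s₁, …, sₙ)` exists and has the value `b`. -/
def IterLim : ℕ → (List ℕ → Bool) → Bool → Prop
  | 0, c, b => c [] = b
  | n + 1, c, b => ∀ᶠ s in Filter.atTop, IterLim n (fun l => c (s :: l)) b

theorem IterLim.exists_list {n : ℕ} {c : List ℕ → Bool} {b : Bool} (h : IterLim n c b)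
    {M : Set ℕ} (hM : M.Infinite) (N : ℕ) : ∃ l : List ℕ, l.length = n ∧ l.Pairwise (· < ·) ∧
      (∀ x ∈ l, x ∈ M ∧ N ≤ x) ∧ c l = b := by
  induction n generalizing c N with
  | zero => exact ⟨[], rfl, List.Pairwise.nil, by simp, h⟩
  | succ n ih =>
    obtain ⟨K, hK⟩ := Filter.eventually_atTop.1 h
    obtain ⟨s, hs, hlt⟩ := hM.exists_gt (max K N)
    obtain ⟨l, h1, h2, h3, h4⟩ := ih (hK s ((le_max_left _ _).trans hlt.le)) (s + 1)
    refine ⟨s :: l, by simp [h1], List.pairwise_cons.2 ⟨fun x hx => (h3 x hx).2, h2⟩, ?_, h4⟩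
    have hN : N ≤ s := (le_max_right _ _).trans hlt.le
    intro x hx
    rcases List.mem_cons.1 hx with rfl | hx
    · exact ⟨hs, hN⟩
    · exact ⟨(h3 x hx).1, by have := (h3 x hx).2; omega⟩

/-- The innermost limit of `c (s₁, …, sₙ)` exists. -/
def StableList (n : ℕ) (c : List ℕ → Bool) : Prop :=
  ∀ l : List ℕ, l.length + 1 = n → ∃ b, ∀ᶠ s in Filter.atTop, c (l ++ [s]) = b

theorem exists_iterLim_of_delta (n : ℕ) :
    (∀ A : Set Baire, BorelDelta n A → ∃ c : Baire → List ℕ → Bool,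
      (∀ l, Continuous fun x => c x l) ∧ (∀ x, 1 ≤ n → StableList n (c x)) ∧
      ∀ x, (x ∈ A → IterLim n (c x) true) ∧ (x ∉ A → IterLim n (c x) false)) ∧
    ∀ A₀ A₁ : Set Baire, BorelSigma (n + 1) A₀ → BorelSigma (n + 1) A₁ →
      ∃ c : Baire → List ℕ → Bool, (∀ l, Continuous fun x => c x l) ∧
      (∀ x, 1 ≤ n → StableList (n + 1) (c x)) ∧
      ∀ x, (x ∈ A₀ → x ∉ A₁ → IterLim (n + 1) (c x) true) ∧
        (x ∈ A₁ → x ∉ A₀ → IterLim (n + 1) (c x) false) := by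
  classical
  have step : ∀ n, (∀ A : Set Baire, BorelDelta n A → ∃ c : Baire → List ℕ → Bool,
      (∀ l, Continuous fun x => c x l) ∧ (∀ x, 1 ≤ n → StableList n (c x)) ∧
      ∀ x, (x ∈ A → IterLim n (c x) true) ∧ (x ∉ A → IterLim n (c x) false)) →
      ∀ A₀ A₁ : Set Baire, BorelSigma (n + 1) A₀ → BorelSigma (n + 1) A₁ →
      ∃ c : Baire → List ℕ → Bool, (∀ l, Continuous fun x => c x l) ∧
      (∀ x, 1 ≤ n → StableList (n + 1) (c x)) ∧
      ∀ x, (x ∈ A₀ → x ∉ A₁ → IterLim (n + 1) (c x) true) ∧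
        (x ∈ A₁ → x ∉ A₀ → IterLim (n + 1) (c x) false) := by
    intro n ih A₀ A₁ h₀ h₁
    obtain ⟨E, hE, hE₀, hE₁⟩ := exists_limit_separation h₀ h₁
    choose c hc hs hlim using fun s => ih (E s) (hE s)
    refine ⟨fun x l => match l with | [] => false | s :: l => c s x l, ?_, ?_, ?_⟩
    · rintro (_ | ⟨s, l⟩)
      · exact continuous_const
      · exact hc s l
    · rintro x hn (_ | ⟨s, l⟩) hl
      · simp at hl; omega
      · exact hs s x hn l (by simpa using hl)
    · intro x
      constructor
      · intro h h'
        filter_upwards [hE₀ x h h'] with s hs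
        exact (hlim s x).1 hs
      · intro h h'
        filter_upwards [hE₁ x h h'] with s hs
        exact (hlim s x).2 hs
  suffices H : ∀ A : Set Baire, BorelDelta n A → ∃ c : Baire → List ℕ → Bool,
      (∀ l, Continuous fun x => c x l) ∧ (∀ x, 1 ≤ n → StableList n (c x)) ∧
      ∀ x, (x ∈ A → IterLim n (c x) true) ∧ (x ∉ A → IterLim n (c x) false) from
    ⟨H, step n H⟩
  induction n with
  | zero =>
    intro A hA
    refine ⟨fun x _ => decide (x ∈ A), fun _ => ?_, fun x h => by omega, fun x => ?_⟩
    · have e : (fun x : Baire => decide (x ∈ A)) ⁻¹' {true} = A := by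
        ext x
        simp
      have hA' : IsClopen A := ⟨isOpen_compl_iff.1 hA.2, hA.1⟩
      exact (continuous_bool_rng true).2 (e.symm ▸ hA')
    · constructor <;> intro h <;> simp [IterLim, h]
  | succ n ih =>
    intro A hA
    obtain ⟨c, hc, hs, hlim⟩ := step n ih A Aᶜ hA.1 hA.2
    have hlim' : ∀ x, (x ∈ A → IterLim (n + 1) (c x) true) ∧
        (x ∉ A → IterLim (n + 1) (c x) false) :=
      fun x => ⟨fun h => (hlim x).1 h (by simpa using h), fun h => (hlim x).2 h h⟩
    refine ⟨c, hc, fun x _ => ?_, hlim'⟩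
    rcases Nat.eq_zero_or_pos n with rfl | hn
    · intro l hl
      obtain rfl : l = [] := by simpa using hl
      by_cases hx : x ∈ A
      · exact ⟨true, (hlim' x).1 hx⟩
      · exact ⟨false, (hlim' x).2 hx⟩
    · exact hs x hn

/-! ### Colorings with prescribed iterated limits -/

theorem sort_insert_of_lt {A : Finset ℕ} {i : ℕ} (h : ∀ a ∈ A, a < i) :
    (insert i A).sort (· ≤ ·) = A.sort (· ≤ ·) ++ [i] := by
  have hi : i ∉ A := fun hi => lt_irrefl _ (h i hi)
  refine List.Perm.eq_of_pairwise' (r := (· ≤ ·)) (Finset.pairwise_sort _ _) ?_ ?_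
  · refine List.pairwise_append.2 ⟨Finset.pairwise_sort _ _, by simp, fun a ha b hb => ?_⟩
    rw [List.mem_singleton.1 hb]
    exact (h a (by simpa using ha)).le
  · refine (List.perm_ext_iff_of_nodup (Finset.sort_nodup _ _) ?_).2 fun a => ?_
    · refine List.nodup_append.2 ⟨Finset.sort_nodup _ _, by simp, fun a ha b hb => ?_⟩
      rw [List.mem_singleton.1 hb]
      exact (h a (by simpa using ha)).ne
    · simp [or_comm]

/-- The coloring of `n`-element sets given by a two-valued function on lists. -/
def toColoring (n : ℕ) {k : ℕ∞} (hk : 2 ≤ k) (c : List ℕ → Bool) : Coloring n k :=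
  ⟨fun A => (c (A.1.sort (· ≤ ·))).toNat, by
    refine ⟨fun A => lt_of_lt_of_le ?_ hk, (Set.finite_lt_nat 2).subset ?_⟩
    · exact_mod_cast Bool.toNat_lt _
    · rintro _ ⟨A, rfl⟩
      exact Bool.toNat_lt _⟩

theorem isStableColoring_toColoring {n : ℕ} {k : ℕ∞} (hk : 2 ≤ k) {c : List ℕ → Bool}
    (hc : StableList n c) : IsStableColoring (toColoring n hk c) := by
  intro A hA
  obtain ⟨b, hb⟩ := hc (A.sort (· ≤ ·)) (by rw [Finset.length_sort, hA])
  refine ⟨b.toNat, ?_⟩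
  filter_upwards [hb, Filter.eventually_gt_atTop (A.sup id)] with i hi hlt h
  have hlt' : ∀ a ∈ A, a < i := fun a ha => lt_of_le_of_lt (Finset.le_sup (f := id) ha) hlt
  simp only [toColoring]
  rw [sort_insert_of_lt hlt', hi]

theorem sort_toFinset_of_pairwise {l : List ℕ} (hl : l.Pairwise (· < ·)) :
    l.toFinset.sort (· ≤ ·) = l := by
  have hnd : l.Nodup := hl.sortedLT.nodup
  refine List.Perm.eq_of_pairwise' (r := (· ≤ ·)) (Finset.pairwise_sort _ _)
    (hl.imp le_of_lt) ?_
  refine (List.perm_ext_iff_of_nodup (Finset.sort_nodup _ _) hnd).2 fun a => ?_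
  simp

/-- On a homogeneous set of a coloring of lists, all increasing lists have the same color. -/
theorem exists_color_of_mem_homogeneousSets {n : ℕ} {k : ℕ∞} {hk : 2 ≤ k} {c : List ℕ → Bool}
    {M : Set ℕ} (hM : M ∈ homogeneousSets (toColoring n hk c)) : ∃ b, ∀ l : List ℕ,
      l.length = n → l.Pairwise (· < ·) → (∀ x ∈ l, x ∈ M) → c l = b := by
  obtain ⟨-, a, ha⟩ := hM
  refine ⟨decide (a = 1), fun l hl hp hmem => ?_⟩
  have hcard : l.toFinset.card = n := by
    rw [List.toFinset_card_of_nodup hp.sortedLT.nodup, hl]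
  have := ha ⟨l.toFinset, hcard⟩ fun x hx => hmem x (by simpa using hx)
  simp only [toColoring, sort_toFinset_of_pairwise hp] at this
  rw [← this]
  cases c l <;> simp

/-- No effectively `𝚺⁰ₙ₊₂`-measurable function finds infinite homogeneous sets for all two-valued
colorings of `(n + 1)`-element sets, not even for the stable ones if `1 ≤ n`. -/
theorem not_effectivelySigmaMeasurable_of_family {n : ℕ} {k : ℕ∞} (hk : 2 ≤ k)
    (f : Problem (Coloring (n + 1) k) (Set ℕ)) (hsol : ∀ c, f.sol c = homogeneousSets c)
    (hdom : ∀ c : List ℕ → Bool, (1 ≤ n → StableList (n + 1) c) →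
      toColoring (n + 1) hk c ∈ f.dom) :
    ¬ f.EffectivelySigmaMeasurable (n + 2) := by
  rintro ⟨F, hF, Φ, -, hΦ⟩
  let A : ℕ → Set Baire := fun i => {x | x ∈ sigmaSet (n + 2) (x.row i)}
  have hA : ∀ i, BorelSigma (n + 1) (A i) :=
    fun i => borelSigma_sigmaSet (n + 1) continuous_id (continuous_row i)
  obtain ⟨c, hc, hs, hlim⟩ := (exists_iterLim_of_delta n).2 (A 0) (A 1) (hA 0) (hA 1)
  let g : Baire → Baire := fun x i => (toColoring (n + 1) hk (c x)).1 (theta (n + 1) i)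
  have hg : Continuous g := continuous_pi fun i =>
    (continuous_of_discreteTopology (f := Bool.toNat)).comp (hc _)
  have hreal : ∀ x, ∃ q ∈ F (g x), ∃ M ∈ homogeneousSets (toColoring (n + 1) hk (c x)),
      RepresentedSpace.Names q M := by
    intro x
    rw [← hsol]
    exact hF (g x) _ (fun i => rfl) (hdom (c x) (hs x))
  choose q hq M hM hqM using hreal
  have hqM' : ∀ x i, q x i = 1 ↔ i ∈ M x := by
    intro x i
    constructor
    · intro h
      by_contra h'
      rw [(hqM x i).2 h'] at h
      exact absurd h (by norm_num)
    · exact (hqM x i).1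
  let U : List ℕ → Set Baire := fun l => {y | ∀ i ∈ l, y i = 1}
  have hU : ∀ l, IsOpen (U l) := by
    intro l
    have : U l = ⋂ i ∈ l.toFinset, {y : Baire | y i = 1} := by
      ext y
      simp [U]
    rw [this]
    exact isOpen_biInter_finset fun i _ =>
      (isOpen_discrete {1}).preimage (continuous_apply i)
  have hpre : ∀ l, BorelSigma (n + 1) {x | q x ∈ U l} := by
    intro l
    obtain ⟨p, hp⟩ := BorelSigma.exists_name (m := 0) (hU l)
    have : {x | q x ∈ U l} = g ⁻¹' {y | y ∈ sigmaSet (n + 2) (Φ p)} := by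
      ext x
      have hx : g x ∈ F.preimage (sigmaSet 1 p) ↔ q x ∈ U l := by
        rw [hp, PFun.mem_preimage]
        constructor
        · rintro ⟨y, hy, hy'⟩
          rwa [Part.mem_unique (hq x) hy']
        · intro h
          exact ⟨_, h, hq x⟩
      have hd : g x ∈ F.Dom := (PFun.mem_dom F _).2 ⟨_, hq x⟩
      rw [Set.mem_ofPred_eq, ← hx, hΦ p]
      simp [hd]
    rw [this]
    exact (borelSigma_sigmaSet (n + 1) continuous_id continuous_const).preimage hg
  let E : Bool → Set Baire := fun b =>
    ⋃ l : List ℕ, {x | (l.length = n + 1 ∧ l.Pairwise (· < ·)) ∧ c x l = b} ∩ {x | q x ∈ U l}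
  have hE : ∀ b, BorelSigma (n + 1) (E b) := by
    intro b
    refine BorelSigma.iUnion_countable fun l => BorelSigma.inter (.of_isClopen ?_) (hpre l)
    by_cases hl : l.length = n + 1 ∧ l.Pairwise (· < ·)
    · simp only [hl, true_and]
      exact (isClopen_discrete {b}).preimage (hc l)
    · simp only [hl, false_and]
      exact isClopen_empty
  have hmem : ∀ x b, x ∈ E b ↔ ∃ l : List ℕ, (l.length = n + 1 ∧ l.Pairwise (· < ·)) ∧
      c x l = b ∧ ∀ i ∈ l, i ∈ M x := by
    intro x b
    simp only [E, U, Set.mem_iUnion, Set.mem_inter_iff, Set.mem_ofPred_eq, hqM', and_assoc]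
  have hdisj : ∀ x, x ∈ E true → x ∉ E false := by
    intro x h h'
    obtain ⟨b, hb⟩ := exists_color_of_mem_homogeneousSets (hM x)
    obtain ⟨l, hl, e, hlM⟩ := (hmem x _).1 h
    obtain ⟨l', hl', e', hlM'⟩ := (hmem x _).1 h'
    rw [hb l hl.1 hl.2 hlM] at e
    rw [hb l' hl'.1 hl'.2 hlM', e] at e'
    exact Bool.noConfusion e'
  have hlimE : ∀ x b, IterLim (n + 1) (c x) b → x ∈ E b := by
    intro x b h
    obtain ⟨l, h1, h2, h3, h4⟩ := h.exists_list (hM x).1 0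
    exact (hmem x b).2 ⟨l, ⟨h1, h2⟩, h4, fun i hi => (h3 i hi).1⟩
  have hcover : ∀ x, x ∉ E true → x ∈ E false := by
    intro x h
    obtain ⟨l, h1, h2, h3⟩ : ∃ l : List ℕ, l.length = n + 1 ∧ l.Pairwise (· < ·) ∧
        ∀ i ∈ l, i ∈ M x := by
      obtain ⟨t, ht, hcard⟩ := (hM x).1.exists_subset_card_eq (n + 1)
      exact ⟨t.sort (· ≤ ·), by rw [Finset.length_sort, hcard],
        (Finset.sortedLT_sort t).pairwise, fun i hi => ht (by simpa using hi)⟩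
    cases hb : c x l with
    | true => exact absurd ((hmem x _).2 ⟨l, ⟨h1, h2⟩, hb, h3⟩) h
    | false => exact (hmem x _).2 ⟨l, ⟨h1, h2⟩, hb, h3⟩
  obtain ⟨p₀, hp₀⟩ := (hE false).exists_name
  obtain ⟨p₁, hp₁⟩ := (hE true).exists_name
  obtain ⟨x, hx⟩ := exists_rows fun i => if i = 0 then p₀ else p₁
  have hx₀ : x ∈ A 0 ↔ x ∈ E false := by
    rw [hp₀]
    simp [A, hx]
  have hx₁ : x ∈ A 1 ↔ x ∈ E true := by
    rw [hp₁]
    simp [A, hx]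
  by_cases h : x ∈ E true
  · exact hdisj x h (hlimE x false ((hlim x).2 (hx₁.2 h) fun h' => hdisj x h (hx₀.1 h')))
  · exact h (hlimE x true ((hlim x).1 (hx₀.2 (hcover x h)) fun h' => h (hx₁.1 h')))

theorem corollary4p20 (n : ℕ) (hn : 1 ≤ n) (k : ℕ∞) (hk : 2 ≤ k) :
    (SRT n k).EffectivelySigmaMeasurable (n + 2) ∧
    (RT n k).EffectivelySigmaMeasurable (n + 2) ∧
    ¬ (RT n k).EffectivelySigmaMeasurable (n + 1) ∧
    (2 ≤ n → ¬ (SRT n k).EffectivelySigmaMeasurable (n + 1)) := by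
  obtain ⟨n, rfl⟩ : ∃ m, n = m + 1 := ⟨n - 1, by omega⟩
  refine ⟨SRT_effectivelySigmaMeasurable _ k, RT_effectivelySigmaMeasurable _ k, ?_, fun h2 => ?_⟩
  · exact not_effectivelySigmaMeasurable_of_family hk _ (fun _ => rfl) fun _ _ => trivial
  · exact not_effectivelySigmaMeasurable_of_family hk _ (fun _ => rfl) fun c hc =>
      isStableColoring_toColoring hk (hc (by omega))
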